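/- Let $\mathrm{Skew}_6(\mathbb C)$ be the space of $6\times 6$ complex skew-symmetric matrices. A \emph{plane of constant rank four} is a projective plane $\pi=\mathbb P(W)$, where $W\subset \mathrm{Skew}_6(\mathbb C)$ is a linear subspace of dimension $3$ all of whose nonzero elements have rank exactly $4$. The group $PGL_6(\mathbb C)$ acts on such planes by $[g]\cdot\mathbb P(W)=\mathbb P(\{gMg^{t} : M\in W\})$; two planes are $PGL_6$-equivalent if they lie in the same orbit. Let $e_0,\dots,e_5$ be the standard basis of $\mathbb C^6$ and identify $e_i\wedge e_j$ with the skew-symmetric matrix $E_{ij}-E_{ji}$. Let \begin{align*} \pi_g&=\langle e_0\wedge e_4-e_1\wedge e_3,\ e_0\wedge e_5-e_2\wedge e_3,\ e_1\wedge e_5-e_2\wedge e_4\rangle,\\ \pi_t&=\langle e_0\wedge e_2+e_1\wedge e_3,\ e_0\wedge e_3+e_1\wedge e_4,\ e_0\wedge e_4+e_1\wedge e_5\rangle,\\ \pi_p&=\langle e_0\wedge e_3+e_1\wedge e_2,\ e_0\wedge e_4+e_2\wedge e_3,\ e_0\wedge e_5+e_1\wedge e_3\rangle,\\ \pi_5&=\langle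 e_0\wedge e_3+e_1\wedge e_2,\ e_0\wedge e_4+e_1\wedge e_3,\ e_1\wedge e_4+e_2\wedge e_3\rangle. \end{align*} \textbf{Theorem.} The four planes $\pi_g,\pi_t,\pi_p,\pi_5$ are planes of constant rank four, and every plane of constant rank four is $PGL_6$-equivalent to exactly one of them. -/

import Mathlib

open scoped MatrixGroups

noncomputable section

namespace SkewPlanes

/-- Complex matrices of order six, with rows and columns indexed by `0, …, 5`. -/
abbrev Mat6 : Type := Matrix (Fin 6) (Fin 6) ℂ

/-- A projective plane of skew-symmetric matrices of constant rank four, given by the underlying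
three-dimensional linear space: all its members are skew-symmetric, and all its nonzero members
have rank four. -/
structure IsConstantRankFourPlane (π : Submodule ℂ Mat6) : Prop where
  finrank_eq : Module.finrank ℂ π = 3
  skew : ∀ M ∈ π, M.transpose = -M
  rank_eq : ∀ M ∈ π, M ≠ 0 → M.rank = 4

/-- The linear map `M ↦ g M gᵀ`. On skew-symmetric matrices, viewed as tensors in `⋀² ℂ⁶`, this is
the natural action of `g`: it sends `x yᵀ - y xᵀ` to `(g x) (g y)ᵀ - (g y) (g x)ᵀ`. -/
def congruence (g : GL (Fin 6) ℂ) : Mat6 →ₗ[ℂ] Mat6 where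
  toFun M := g.val * M * g.val.transpose
  map_add' M N := by rw [mul_add, add_mul]
  map_smul' c M := by simp

/-- The action of `GL₆` on linear spaces of matrices. -/
def glAction : GL (Fin 6) ℂ →* Function.End (Submodule ℂ Mat6) where
  toFun g π := π.map (congruence g)
  map_one' := by
    funext π
    have h : congruence 1 = LinearMap.id := by
      ext1 M
      simp [congruence]
    rw [h]
    exact Submodule.map_id π
  map_mul' g h := by
    funext π
    have e : congruence (g * h) = congruence g ∘ₗ congruence h := by
      refine LinearMap.ext fun M => ?_
      simp [congruence, Matrix.transpose_mul, mul_assoc]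
    rw [e]
    exact Submodule.map_comp _ _ _

/-- Scalar matrices fix every linear space of matrices. -/
theorem glAction_scalar :
    glAction.comp (Matrix.GeneralLinearGroup.scalar (Fin 6)) = 1 := by
  ext1 u
  funext π
  have e : congruence (Matrix.GeneralLinearGroup.scalar (Fin 6) u)
      = ((u : ℂ) * (u : ℂ)) • LinearMap.id := by
    refine LinearMap.ext fun M => ?_
    ext i j
    simp [congruence, Matrix.GeneralLinearGroup.scalar, Matrix.scalar_apply]
    ring
  change π.map (congruence (Matrix.GeneralLinearGroup.scalar (Fin 6) u)) = π
  rw [e, Submodule.map_smul _ _ _ (by simp), Submodule.map_id]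

/-- The induced action of `PGL₆` on linear spaces of matrices. -/
def pglAction : PGL(6, ℂ) →* Function.End (Submodule ℂ Mat6) :=
  Matrix.ProjGenLinGroup.lift glAction glAction_scalar

/-- Two linear spaces of matrices are equivalent if they lie in the same `PGL₆`-orbit. -/
def PGLEquivalent (π π' : Submodule ℂ Mat6) : Prop :=
  ∃ g : PGL(6, ℂ), pglAction g π = π'

/-- The skew-symmetric matrix of the tensor `eᵢ ∧ eⱼ`. -/
def wedge (i j : Fin 6) : Mat6 :=
  Matrix.single i j 1 - Matrix.single j i 1

/-- The plane `π_g`. -/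
def planeG : Submodule ℂ Mat6 :=
  Submodule.span ℂ {wedge 0 4 - wedge 1 3, wedge 0 5 - wedge 2 3, wedge 1 5 - wedge 2 4}

/-- The plane `π_t`. -/
def planeT : Submodule ℂ Mat6 :=
  Submodule.span ℂ {wedge 0 2 + wedge 1 3, wedge 0 3 + wedge 1 4, wedge 0 4 + wedge 1 5}

/-- The plane `π_p`. -/
def planeP : Submodule ℂ Mat6 :=
  Submodule.span ℂ {wedge 0 3 + wedge 1 2, wedge 0 4 + wedge 2 3, wedge 0 5 + wedge 1 3}

/-- The plane `π_5`, contained in `⋀²` of the hyperplane spanned by the first five basis vectors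
(which are indexed here by `0, …, 4`). -/
def planeFive : Submodule ℂ Mat6 :=
  Submodule.span ℂ {wedge 0 3 + wedge 1 2, wedge 0 4 + wedge 1 3, wedge 1 4 + wedge 2 3}

/-- Labels for the four standard planes. -/
inductive PlaneType : Type
  | g
  | t
  | p
  | five

/-- The four standard planes `π_g`, `π_t`, `π_p`, `π_5`. -/
def standardPlane : PlaneType → Submodule ℂ Mat6
  | .g => planeG
  | .t => planeT
  | .p => planeP
  | .five => planeFive

end SkewPlanes

end

/-! Everything rests on restricting a plane to its pencils. By the skew Kronecker classification, a
pencil of constant rank four in `⋀² ℂ⁶` has minimal indices `(1,1)` or `(0,2)`: in a suitable frame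
it is spanned by `b0∧b2 + b1∧b3` and either `b0∧b4 + b1∧b5` (generic) or `b0∧b3 + b1∧b4` (special,
with a common kernel vector). This is `pencil_type`. The main tool is `pf6_eq_zero`: the Pfaffian
vanishes on the whole plane, so every coefficient of this cubic in the parameters of the plane gives
an equation.

Suppose the plane contains a generic pencil `A, B`, and let `C` be a third generator. Vanishing of
the Pfaffian of `sA + tB + C` forces the part of `C` outside `⟨b0,b1⟩∧V` to be `c24 b2∧b4 + c34
(b2∧b5 + b3∧b4) + c35 b3∧b5`, that is, a binary quadratic form. If it is zero, a square, or a
product of two distinct factors, the plane is `π_t`, `π_p` or `π_g` respectively. In the zero case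
the plane is a pencil of `3 × 4` matrices of constant rank three, brought to normal form by
`exists_kronecker_chain`.

If every pencil is special, any two members share a kernel vector, and `exists_common_kernel`
upgrades this to one vector for the whole plane. The part of `C` outside `⟨b0,b1⟩∧V` now lies in
`⋀²⟨b2,b3,b4⟩`, again a space of binary quadratic forms. It cannot vanish, since a root of a cubic
would yield a member of rank two, and every nonzero form leads to `π_5`.

The four types are separated by two invariants: a common kernel vector, which only `π_5` has, and
the number of independent vectors orthogonal to the kernels of all nonzero members, which is 0, 1, 2
for `π_g`, `π_p`, `π_t`. -/

noncomputable section

namespace SkewPlanes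

open Matrix

/-! ### Decomposable bivectors and their ranks -/

/-- The decomposable skew-symmetric matrix `x ∧ y = x yᵀ - y xᵀ`. -/
def vw (x y : Fin 6 → ℂ) : Mat6 := vecMulVec x y - vecMulVec y x

theorem vw_apply (x y : Fin 6 → ℂ) (i j : Fin 6) : vw x y i j = x i * y j - y i * x j := by
  simp [vw, vecMulVec_apply]

theorem vw_mulVec (x y v : Fin 6 → ℂ) : vw x y *ᵥ v = (y ⬝ᵥ v) • x - (x ⬝ᵥ v) • y := by
  ext i
  simp [vw, sub_mulVec, vecMulVec_mulVec]

theorem rank_vw_add_vw_le (x y z w : Fin 6 → ℂ) :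
    (vw x y + vw z w).rank ≤ Module.finrank ℂ (Submodule.span ℂ (Set.range ![x, y, z, w])) := by
  refine Submodule.finrank_mono ?_
  rintro _ ⟨v, rfl⟩
  have h : ∀ i, ![x, y, z, w] i ∈ Submodule.span ℂ (Set.range ![x, y, z, w]) :=
    fun i => Submodule.subset_span ⟨i, rfl⟩
  rw [mulVecLin_apply, add_mulVec, vw_mulVec, vw_mulVec]
  exact add_mem
    (sub_mem (Submodule.smul_mem _ _ (h 0)) (Submodule.smul_mem _ _ (h 1)))
    (sub_mem (Submodule.smul_mem _ _ (h 2)) (Submodule.smul_mem _ _ (h 3)))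

/-- The range lies in the span of the four vectors, so rank four leaves no room for a relation. -/
theorem linearIndependent_of_rank_vw_add_vw {x y z w : Fin 6 → ℂ}
    (h : (vw x y + vw z w).rank = 4) : LinearIndependent ℂ ![x, y, z, w] := by
  rw [linearIndependent_iff_card_le_finrank_span, Fintype.card_fin]
  exact h.symm.le.trans (rank_vw_add_vw_le x y z w)

theorem rank_vw_le (x y : Fin 6 → ℂ) : (vw x y).rank ≤ 2 := by
  have h : (vw x y).rank ≤ Module.finrank ℂ (Submodule.span ℂ (Set.range ![x, y])) := by
    refine Submodule.finrank_mono ?_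
    rintro _ ⟨v, rfl⟩
    have h : ∀ i, ![x, y] i ∈ Submodule.span ℂ (Set.range ![x, y]) :=
      fun i => Submodule.subset_span ⟨i, rfl⟩
    rw [mulVecLin_apply, vw_mulVec]
    exact sub_mem (Submodule.smul_mem _ _ (h 0)) (Submodule.smul_mem _ _ (h 1))
  exact h.trans ((finrank_range_le_card (R := ℂ) ![x, y]).trans (by simp))

theorem vw_transpose (x y : Fin 6 → ℂ) : (vw x y).transpose = -vw x y := by
  ext i j
  simp [vw_apply]
  ring

/-! ### Coordinates in a frame and the Pfaffian -/

/-- The skew-symmetric matrix with the given coordinates in the basis `bᵢ ∧ bⱼ`. -/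
def comb (b : Fin 6 → Fin 6 → ℂ)
    (c01 c02 c03 c04 c05 c12 c13 c14 c15 c23 c24 c25 c34 c35 c45 : ℂ) : Mat6 :=
  c01 • vw (b 0) (b 1) + c02 • vw (b 0) (b 2) + c03 • vw (b 0) (b 3) + c04 • vw (b 0) (b 4)
    + c05 • vw (b 0) (b 5) + c12 • vw (b 1) (b 2) + c13 • vw (b 1) (b 3) + c14 • vw (b 1) (b 4)
    + c15 • vw (b 1) (b 5) + c23 • vw (b 2) (b 3) + c24 • vw (b 2) (b 4) + c25 • vw (b 2) (b 5)
    + c34 • vw (b 3) (b 4) + c35 • vw (b 3) (b 5) + c45 • vw (b 4) (b 5)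

/-- The Pfaffian of order six. -/
def pf6 (c01 c02 c03 c04 c05 c12 c13 c14 c15 c23 c24 c25 c34 c35 c45 : ℂ) : ℂ :=
  c01 * (c23 * c45 - c24 * c35 + c25 * c34) - c02 * (c13 * c45 - c14 * c35 + c15 * c34)
    + c03 * (c12 * c45 - c14 * c25 + c15 * c24) - c04 * (c12 * c35 - c13 * c25 + c15 * c23)
    + c05 * (c12 * c34 - c13 * c24 + c14 * c23)

/-- The skew-symmetric matrix with the given entries above the diagonal. -/
def skewMat (c01 c02 c03 c04 c05 c12 c13 c14 c15 c23 c24 c25 c34 c35 c45 : ℂ) : Mat6 :=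
  !![0, c01, c02, c03, c04, c05;
    -c01, 0, c12, c13, c14, c15;
    -c02, -c12, 0, c23, c24, c25;
    -c03, -c13, -c23, 0, c34, c35;
    -c04, -c14, -c24, -c34, 0, c45;
    -c05, -c15, -c25, -c35, -c45, 0]

/-- The Pfaffian adjugate, whose entries are the signed Pfaffians of order four. -/
def pfAdj (c01 c02 c03 c04 c05 c12 c13 c14 c15 c23 c24 c25 c34 c35 c45 : ℂ) : Mat6 :=
  skewMat
    (-(c23 * c45 - c24 * c35 + c25 * c34)) (c13 * c45 - c14 * c35 + c15 * c34)
    (-(c12 * c45 - c14 * c25 + c15 * c24)) (c12 * c35 - c13 * c25 + c15 * c23)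
    (-(c12 * c34 - c13 * c24 + c14 * c23))
    (-(c03 * c45 - c04 * c35 + c05 * c34)) (c02 * c45 - c04 * c25 + c05 * c24)
    (-(c02 * c35 - c03 * c25 + c05 * c23)) (c02 * c34 - c03 * c24 + c04 * c23)
    (-(c01 * c45 - c04 * c15 + c05 * c14)) (c01 * c35 - c03 * c15 + c05 * c13)
    (-(c01 * c34 - c03 * c14 + c04 * c13))
    (-(c01 * c25 - c02 * c15 + c05 * c12)) (c01 * c24 - c02 * c14 + c04 * c12)
    (-(c01 * c23 - c02 * c13 + c03 * c12))

theorem skewMat_mul_pfAdj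
    (c01 c02 c03 c04 c05 c12 c13 c14 c15 c23 c24 c25 c34 c35 c45 : ℂ) :
    skewMat c01 c02 c03 c04 c05 c12 c13 c14 c15 c23 c24 c25 c34 c35 c45 *
      pfAdj c01 c02 c03 c04 c05 c12 c13 c14 c15 c23 c24 c25 c34 c35 c45 =
      pf6 c01 c02 c03 c04 c05 c12 c13 c14 c15 c23 c24 c25 c34 c35 c45 • 1 := by
  ext i j
  fin_cases i <;> fin_cases j <;>
    simp [skewMat, pfAdj, pf6, Matrix.mul_apply, Fin.sum_univ_six] <;> ring

theorem comb_eq (b : Fin 6 → Fin 6 → ℂ)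
    (c01 c02 c03 c04 c05 c12 c13 c14 c15 c23 c24 c25 c34 c35 c45 : ℂ) :
    comb b c01 c02 c03 c04 c05 c12 c13 c14 c15 c23 c24 c25 c34 c35 c45 =
      (of b).transpose * skewMat c01 c02 c03 c04 c05 c12 c13 c14 c15 c23 c24 c25 c34 c35 c45
        * of b := by
  ext i j
  simp [comb, skewMat, vw_apply, Matrix.mul_apply, Fin.sum_univ_six]
  ring

theorem eq_skewMat {M : Mat6} (hM : M.transpose = -M) :
    M = skewMat (M 0 1) (M 0 2) (M 0 3) (M 0 4) (M 0 5) (M 1 2) (M 1 3) (M 1 4) (M 1 5)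
      (M 2 3) (M 2 4) (M 2 5) (M 3 4) (M 3 5) (M 4 5) := by
  have h : ∀ i j, M i j = - M j i := fun i j => by
    have := congrFun (congrFun hM j) i
    simpa using this
  have h0 : ∀ i, M i i = 0 := fun i => by
    have := h i i
    linear_combination this / 2
  ext i j
  fin_cases i <;> fin_cases j <;> simp [skewMat, h0] <;> exact h _ _

theorem isUnit_of_linearIndependent {b : Fin 6 → Fin 6 → ℂ} (hb : LinearIndependent ℂ b) :
    IsUnit (of b) :=
  Matrix.linearIndependent_rows_iff_isUnit.1 hb

theorem linearIndependent_of_isUnit {b : Fin 6 → Fin 6 → ℂ} (hb : IsUnit (of b)) :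
    LinearIndependent ℂ b :=
  Matrix.linearIndependent_rows_iff_isUnit.2 hb

theorem rank_congr {P : Mat6} (hP : IsUnit P) (M : Mat6) :
    (P.transpose * M * P).rank = M.rank := by
  have h : IsUnit P.det := (Matrix.isUnit_iff_isUnit_det _).1 hP
  rw [rank_mul_eq_left_of_isUnit_det _ _ h,
    rank_mul_eq_right_of_isUnit_det _ _ (by rwa [det_transpose])]

/-- A nonzero Pfaffian makes the coordinate matrix invertible, with the Pfaffian adjugate as inverse
up to a scalar; congruence by the frame preserves rank, so the member would have rank six. -/
theorem pf6_eq_zero {π : Submodule ℂ Mat6} (hπ : IsConstantRankFourPlane π)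
    {b : Fin 6 → Fin 6 → ℂ} (hb : LinearIndependent ℂ b)
    {c01 c02 c03 c04 c05 c12 c13 c14 c15 c23 c24 c25 c34 c35 c45 : ℂ}
    (h : comb b c01 c02 c03 c04 c05 c12 c13 c14 c15 c23 c24 c25 c34 c35 c45 ∈ π) :
    pf6 c01 c02 c03 c04 c05 c12 c13 c14 c15 c23 c24 c25 c34 c35 c45 = 0 := by
  by_contra hpf
  have hu : IsUnit (skewMat c01 c02 c03 c04 c05 c12 c13 c14 c15 c23 c24 c25 c34 c35 c45) := by
    refine IsUnit.of_mul_eq_one ((pf6 c01 c02 c03 c04 c05 c12 c13 c14 c15 c23 c24 c25 c34 c35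
      c45)⁻¹ • pfAdj c01 c02 c03 c04 c05 c12 c13 c14 c15 c23 c24 c25 c34 c35 c45) ?_
    rw [mul_smul_comm, skewMat_mul_pfAdj, smul_smul, inv_mul_cancel₀ hpf, one_smul]
  have hr := rank_congr (isUnit_of_linearIndependent hb)
    (skewMat c01 c02 c03 c04 c05 c12 c13 c14 c15 c23 c24 c25 c34 c35 c45)
  rw [← comb_eq, rank_of_isUnit _ hu] at hr
  by_cases h0 : comb b c01 c02 c03 c04 c05 c12 c13 c14 c15 c23 c24 c25 c34 c35 c45 = 0
  · rw [h0] at hr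
    simp at hr
  · rw [hπ.rank_eq _ h h0] at hr
    simp at hr

/-- The dual frame consists of the columns of the inverse of the matrix with rows `v i`. Since `v i
⬝ᵥ M *ᵥ v j` are the entries of the congruent matrix, they are the coordinates of `M` in the
bivectors `b i ∧ b j`. -/
theorem exists_dual {v : Fin 6 → Fin 6 → ℂ} (hv : LinearIndependent ℂ v) :
    ∃ b : Fin 6 → Fin 6 → ℂ, LinearIndependent ℂ b ∧
      (∀ i j, v i ⬝ᵥ b j = if i = j then 1 else 0) ∧
      ∀ M : Mat6, M.transpose = -M → M = comb b
        (v 0 ⬝ᵥ M *ᵥ v 1) (v 0 ⬝ᵥ M *ᵥ v 2) (v 0 ⬝ᵥ M *ᵥ v 3) (v 0 ⬝ᵥ M *ᵥ v 4)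
        (v 0 ⬝ᵥ M *ᵥ v 5) (v 1 ⬝ᵥ M *ᵥ v 2) (v 1 ⬝ᵥ M *ᵥ v 3) (v 1 ⬝ᵥ M *ᵥ v 4)
        (v 1 ⬝ᵥ M *ᵥ v 5) (v 2 ⬝ᵥ M *ᵥ v 3) (v 2 ⬝ᵥ M *ᵥ v 4) (v 2 ⬝ᵥ M *ᵥ v 5)
        (v 3 ⬝ᵥ M *ᵥ v 4) (v 3 ⬝ᵥ M *ᵥ v 5) (v 4 ⬝ᵥ M *ᵥ v 5) := by
  have hu := isUnit_of_linearIndependent hv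
  obtain ⟨u, huv⟩ := hu
  have h1 : of v * (↑u⁻¹ : Mat6) = 1 := by rw [← huv]; exact u.mul_inv
  have h2 : (↑u⁻¹ : Mat6) * of v = 1 := by rw [← huv]; exact u.inv_mul
  refine ⟨fun i j => (↑u⁻¹ : Mat6) j i, ?_, ?_, ?_⟩
  · apply linearIndependent_of_isUnit
    rw [show (of fun i j => (↑u⁻¹ : Mat6) j i) = (↑u⁻¹ : Mat6).transpose from rfl]
    exact (Matrix.isUnit_transpose _).2 (u⁻¹).isUnit
  · intro i j
    have := congrFun (congrFun h1 i) j
    rw [Matrix.mul_apply, Matrix.one_apply] at this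
    exact this
  · intro M hM
    have hN : (of v * M * (of v).transpose).transpose = -(of v * M * (of v).transpose) := by
      simp [Matrix.transpose_mul, hM, mul_assoc]
    have hc : ∀ i j, (of v * M * (of v).transpose) i j = v i ⬝ᵥ M *ᵥ v j := by
      intro i j
      rw [mul_assoc, Matrix.mul_apply]
      rfl
    have hs := eq_skewMat hN
    simp only [hc] at hs
    rw [comb_eq, ← hs]
    rw [show (of fun i j => (↑u⁻¹ : Mat6) j i) = (↑u⁻¹ : Mat6).transpose from rfl,
      transpose_transpose]
    calc M = ((↑u⁻¹ : Mat6) * of v) * M * ((↑u⁻¹ : Mat6) * of v).transpose := by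
          rw [h2]; simp
      _ = _ := by rw [transpose_mul]; simp only [mul_assoc]

theorem exists_comb {b : Fin 6 → Fin 6 → ℂ} (hb : LinearIndependent ℂ b) {M : Mat6}
    (hM : M.transpose = -M) :
    ∃ c01 c02 c03 c04 c05 c12 c13 c14 c15 c23 c24 c25 c34 c35 c45 : ℂ,
      M = comb b c01 c02 c03 c04 c05 c12 c13 c14 c15 c23 c24 c25 c34 c35 c45 := by
  have hu := isUnit_of_linearIndependent hb
  obtain ⟨u, huv⟩ := hu
  have h2 : (↑u⁻¹ : Mat6) * of b = 1 := by rw [← huv]; exact u.inv_mul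
  have hN : ((↑u⁻¹ : Mat6).transpose * M * (↑u⁻¹ : Mat6)).transpose
      = -((↑u⁻¹ : Mat6).transpose * M * (↑u⁻¹ : Mat6)) := by
    simp [Matrix.transpose_mul, hM, mul_assoc]
  have key : M = (of b).transpose * ((↑u⁻¹ : Mat6).transpose * M * (↑u⁻¹ : Mat6)) * of b := by
    calc M = ((↑u⁻¹ : Mat6) * of b).transpose * M * ((↑u⁻¹ : Mat6) * of b) := by
          rw [h2]; simp
      _ = _ := by rw [transpose_mul]; simp only [mul_assoc]
  rw [eq_skewMat hN, ← comb_eq] at key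
  exact ⟨_, _, _, _, _, _, _, _, _, _, _, _, _, _, _, key⟩

/-! ### Skew normal forms -/

/-- Splitting off a hyperbolic plane that contains a prescribed vector of the range. -/
theorem exists_rank_sub_vw {M : Mat6} (hM : M.transpose = -M) {ξ : Fin 6 → ℂ}
    (hξ : M *ᵥ ξ ≠ 0) : ∃ y : Fin 6 → ℂ, (M - vw (M *ᵥ ξ) y).rank + 2 ≤ M.rank := by
  have hs : ∀ v w : Fin 6 → ℂ, (M *ᵥ v) ⬝ᵥ w = -(v ⬝ᵥ M *ᵥ w) := by
    intro v w
    rw [dotProduct_mulVec, ← mulVec_transpose, hM, neg_mulVec, neg_dotProduct, neg_neg]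
  have h0 : ∀ v : Fin 6 → ℂ, (M *ᵥ v) ⬝ᵥ v = 0 := by
    intro v
    have := hs v v
    rw [dotProduct_comm v] at this
    linear_combination this / 2
  obtain ⟨i, hi⟩ := Function.ne_iff.1 hξ
  obtain ⟨η, d, hd, hηd⟩ : ∃ η : Fin 6 → ℂ, ∃ d : ℂ, d ≠ 0 ∧ (M *ᵥ ξ) ⬝ᵥ η = d :=
    ⟨Pi.single i 1, (M *ᵥ ξ) i, hi, by simp⟩
  have hdξ : (M *ᵥ η) ⬝ᵥ ξ = -d := by rw [hs, dotProduct_comm, hηd]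
  -- Skew Gram–Schmidt: with this scaling the difference kills `ξ` and `η` as well as `ker M`, and
  -- `ξ, η` are independent modulo `ker M` because `M` pairs them to `d ≠ 0`.
  refine ⟨-(d⁻¹ • M *ᵥ η), ?_⟩
  set N := M - vw (M *ᵥ ξ) (-(d⁻¹ • M *ᵥ η)) with hN
  have hle : LinearMap.ker M.mulVecLin ⊔ Submodule.span ℂ (Set.range ![ξ, η])
      ≤ LinearMap.ker N.mulVecLin := by
    refine sup_le ?_ (Submodule.span_le.2 ?_)
    · intro v hv
      have hv : M *ᵥ v = 0 := by simpa using hv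
      have e1 : (M *ᵥ ξ) ⬝ᵥ v = 0 := by rw [hs, hv]; simp
      have e2 : (M *ᵥ η) ⬝ᵥ v = 0 := by rw [hs, hv]; simp
      simp [hN, vw_mulVec, hv, e1, e2]
    · rintro _ ⟨j, rfl⟩
      fin_cases j
      · simp [hN, vw_mulVec, h0, hdξ, hd]
      · simp [hN, vw_mulVec, h0, hηd, smul_smul, hd]
  have hdis : Disjoint (LinearMap.ker M.mulVecLin) (Submodule.span ℂ (Set.range ![ξ, η])) := by
    rw [Submodule.disjoint_def]
    intro v hv hv'
    have hv : M *ᵥ v = 0 := by simpa using hv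
    obtain ⟨a, b, rfl⟩ : ∃ a b : ℂ, a • ξ + b • η = v := by
      rw [Matrix.range_cons, Matrix.range_cons, Matrix.range_empty, Set.union_empty,
        Set.singleton_union] at hv'
      exact Submodule.mem_span_pair.1 hv'
    have e1 : (M *ᵥ ξ) ⬝ᵥ (a • ξ + b • η) = 0 := by rw [hs, hv]; simp
    have e2 : (M *ᵥ η) ⬝ᵥ (a • ξ + b • η) = 0 := by rw [hs, hv]; simp
    simp [h0, hηd, hdξ, hd] at e1 e2
    simp [e1, e2]
  have hli : LinearIndependent ℂ ![ξ, η] := by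
    rw [LinearIndependent.pair_iff]
    intro a b hab
    have e1 : (M *ᵥ ξ) ⬝ᵥ (a • ξ + b • η) = 0 := by rw [hab]; simp
    have e2 : (M *ᵥ η) ⬝ᵥ (a • ξ + b • η) = 0 := by rw [hab]; simp
    simp [h0, hηd, hdξ, hd] at e1 e2
    exact ⟨e2, e1⟩
  have hfin := Submodule.finrank_sup_add_finrank_inf_eq (LinearMap.ker M.mulVecLin)
    (Submodule.span ℂ (Set.range ![ξ, η]))
  rw [hdis.eq_bot, finrank_bot, finrank_span_eq_card hli] at hfin
  have hmono := Submodule.finrank_mono hle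
  have r1 := LinearMap.finrank_range_add_finrank_ker M.mulVecLin
  have r2 := LinearMap.finrank_range_add_finrank_ker N.mulVecLin
  simp at r1 r2 hfin
  change M.rank + _ = 6 at r1
  change N.rank + _ = 6 at r2
  omega

theorem exists_mulVec_ne_zero {M : Mat6} (hM : M ≠ 0) : ∃ ξ, M *ᵥ ξ ≠ 0 := by
  by_contra! h
  refine hM (Matrix.ext_of_mulVec_single fun i => ?_)
  rw [h, zero_mulVec]

theorem two_le_rank {M : Mat6} (hM : M.transpose = -M) (h0 : M ≠ 0) : 2 ≤ M.rank := by
  obtain ⟨ξ, hξ⟩ := exists_mulVec_ne_zero h0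
  obtain ⟨y, hy⟩ := exists_rank_sub_vw hM hξ
  omega

theorem sub_vw_transpose {M : Mat6} (hM : M.transpose = -M) (x y : Fin 6 → ℂ) :
    (M - vw x y).transpose = -(M - vw x y) := by
  rw [transpose_sub, hM, vw_transpose]
  abel

/-- After one hyperbolic plane is split off the rank is below two, and a nonzero skew matrix has
rank at least two. -/
theorem exists_eq_vw {M : Mat6} (hM : M.transpose = -M) (h : M.rank < 4) :
    ∃ x y, M = vw x y := by
  by_cases h0 : M = 0
  · exact ⟨0, 0, by rw [h0]; simp [vw]⟩
  obtain ⟨ξ, hξ⟩ := exists_mulVec_ne_zero h0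
  obtain ⟨y, hy⟩ := exists_rank_sub_vw hM hξ
  refine ⟨M *ᵥ ξ, y, ?_⟩
  by_contra hne
  have := two_le_rank (sub_vw_transpose hM (M *ᵥ ξ) y) (sub_ne_zero.2 hne)
  omega

/-- A normal form for matrices of rank four with a prescribed vector of the range. -/
theorem exists_eq_vw_add_vw {M : Mat6} (hM : M.transpose = -M) (h : M.rank = 4)
    {ξ : Fin 6 → ℂ} (hξ : M *ᵥ ξ ≠ 0) : ∃ y z w, M = vw (M *ᵥ ξ) y + vw z w := by
  obtain ⟨y, hy⟩ := exists_rank_sub_vw hM hξ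
  obtain ⟨z, w, hzw⟩ := exists_eq_vw (sub_vw_transpose hM (M *ᵥ ξ) y) (by omega)
  exact ⟨y, z, w, by rw [← hzw]; abel⟩

/-! ### A rank criterion, and the constant rank of the four planes -/

theorem skewMat_transpose (c01 c02 c03 c04 c05 c12 c13 c14 c15 c23 c24 c25 c34 c35 c45 : ℂ) :
    (skewMat c01 c02 c03 c04 c05 c12 c13 c14 c15 c23 c24 c25 c34 c35 c45).transpose =
      -skewMat c01 c02 c03 c04 c05 c12 c13 c14 c15 c23 c24 c25 c34 c35 c45 := by
  ext i j
  fin_cases i <;> fin_cases j <;> simp [skewMat]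

/-- If the Pfaffian vanishes, the matrix annihilates its Pfaffian adjugate, which is skew and
nonzero, hence of rank at least two; this bounds the rank by four. A rank below four would make the
matrix decomposable, and the Plücker relations would then kill the adjugate. -/
theorem rank_skewMat_eq_four
    {c01 c02 c03 c04 c05 c12 c13 c14 c15 c23 c24 c25 c34 c35 c45 : ℂ}
    (h0 : pf6 c01 c02 c03 c04 c05 c12 c13 c14 c15 c23 c24 c25 c34 c35 c45 = 0)
    (h1 : pfAdj c01 c02 c03 c04 c05 c12 c13 c14 c15 c23 c24 c25 c34 c35 c45 ≠ 0) :
    (skewMat c01 c02 c03 c04 c05 c12 c13 c14 c15 c23 c24 c25 c34 c35 c45).rank = 4 := by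
  refine le_antisymm ?_ ?_
  · have h2 := two_le_rank (skewMat_transpose _ _ _ _ _ _ _ _ _ _ _ _ _ _ _) h1
    have hmul := skewMat_mul_pfAdj c01 c02 c03 c04 c05 c12 c13 c14 c15 c23 c24 c25 c34 c35 c45
    rw [h0, zero_smul] at hmul
    have := rank_add_rank_le_card_of_mul_eq_zero hmul
    change 2 ≤ (pfAdj _ _ _ _ _ _ _ _ _ _ _ _ _ _ _).rank at h2
    simp at this
    omega
  · by_contra hlt
    obtain ⟨x, y, hxy⟩ := exists_eq_vw (skewMat_transpose c01 c02 c03 c04 c05 c12 c13 c14 c15 c23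
      c24 c25 c34 c35 c45) (not_le.1 hlt)
    have e : ∀ i j, (skewMat c01 c02 c03 c04 c05 c12 c13 c14 c15 c23 c24 c25 c34 c35 c45) i j =
      x i * y j - y i * x j := fun i j => by rw [hxy, vw_apply]
    have e01 := e 0 1
    have e02 := e 0 2
    have e03 := e 0 3
    have e04 := e 0 4
    have e05 := e 0 5
    have e12 := e 1 2
    have e13 := e 1 3
    have e14 := e 1 4
    have e15 := e 1 5
    have e23 := e 2 3
    have e24 := e 2 4
    have e25 := e 2 5
    have e34 := e 3 4
    have e35 := e 3 5
    have e45 := e 4 5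
    simp only [skewMat, of_apply, cons_val] at e01 e02 e03 e04 e05 e12 e13 e14
    simp only [skewMat, of_apply, cons_val] at e15 e23 e24 e25 e34 e35 e45
    subst e01 e02 e03 e04 e05 e12 e13 e14 e15 e23 e24 e25 e34 e35 e45
    apply h1
    ext i j
    fin_cases i <;> fin_cases j <;> simp [pfAdj, skewMat] <;> ring

theorem isConstantRankFourPlane_span {X Y Z : Mat6} (hX : X.transpose = -X)
    (hY : Y.transpose = -Y) (hZ : Z.transpose = -Z)
    (h : ∀ a b c : ℂ, a • X + b • Y + c • Z = 0 → a = 0 ∧ b = 0 ∧ c = 0)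
    (hr : ∀ a b c : ℂ, ¬(a = 0 ∧ b = 0 ∧ c = 0) → (a • X + b • Y + c • Z).rank = 4) :
    IsConstantRankFourPlane (Submodule.span ℂ {X, Y, Z}) where
  finrank_eq := by
    have hli : LinearIndependent ℂ ![X, Y, Z] := by
      rw [Fintype.linearIndependent_iff]
      intro g hg
      obtain ⟨h0, h1, h2⟩ := h (g 0) (g 1) (g 2) (by simpa [Fin.sum_univ_three] using hg)
      intro i
      fin_cases i <;> assumption
    have := finrank_span_eq_card hli
    have hs : Set.range ![X, Y, Z] = {X, Y, Z} := by
      rw [range_cons, range_cons, range_cons, range_empty]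
      ext
      simp only [Set.mem_union, Set.mem_singleton_iff, Set.mem_empty_iff_false, or_false,
        Set.mem_insert_iff]
    rw [hs] at this
    simpa using this
  skew M hM := by
    obtain ⟨a, b, c, rfl⟩ := Submodule.mem_span_triple.1 hM
    simp only [transpose_add, transpose_smul, hX, hY, hZ]
    module
  rank_eq M hM h0 := by
    obtain ⟨a, b, c, rfl⟩ := Submodule.mem_span_triple.1 hM
    refine hr a b c fun ⟨ha, hb, hc⟩ => h0 ?_
    simp [ha, hb, hc]

theorem wedge_transpose (i j : Fin 6) : (wedge i j).transpose = -wedge i j := by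
  simp [wedge]

theorem planeG_eq (a b c : ℂ) : a • (wedge 0 4 - wedge 1 3) + b • (wedge 0 5 - wedge 2 3)
    + c • (wedge 1 5 - wedge 2 4) = skewMat 0 0 0 a b 0 (-a) 0 c (-b) (-c) 0 0 0 0 := by
  ext i j
  fin_cases i <;> fin_cases j <;> simp [wedge, skewMat]

theorem planeT_eq (a b c : ℂ) : a • (wedge 0 2 + wedge 1 3) + b • (wedge 0 3 + wedge 1 4)
    + c • (wedge 0 4 + wedge 1 5) = skewMat 0 a b c 0 0 a b c 0 0 0 0 0 0 := by
  ext i j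
  fin_cases i <;> fin_cases j <;> simp [wedge, skewMat]

theorem planeP_eq (a b c : ℂ) : a • (wedge 0 3 + wedge 1 2) + b • (wedge 0 4 + wedge 2 3)
    + c • (wedge 0 5 + wedge 1 3) = skewMat 0 0 a b c a c 0 0 b 0 0 0 0 0 := by
  ext i j
  fin_cases i <;> fin_cases j <;> simp [wedge, skewMat]

theorem planeFive_eq (a b c : ℂ) : a • (wedge 0 3 + wedge 1 2) + b • (wedge 0 4 + wedge 1 3)
    + c • (wedge 1 4 + wedge 2 3) = skewMat 0 0 a b 0 a b c 0 c 0 0 0 0 0 := by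
  ext i j
  fin_cases i <;> fin_cases j <;> simp [wedge, skewMat]

theorem isConstantRankFourPlane_planeG : IsConstantRankFourPlane planeG := by
  refine isConstantRankFourPlane_span ?_ ?_ ?_ ?_ ?_
  iterate 3 simp only [transpose_sub, wedge_transpose]; abel
  · intro a b c h
    rw [planeG_eq] at h
    have e1 := congrFun (congrFun h 0) 4
    have e2 := congrFun (congrFun h 0) 5
    have e3 := congrFun (congrFun h 1) 5
    simp [skewMat] at e1 e2 e3
    exact ⟨e1, e2, e3⟩
  · intro a b c h
    rw [planeG_eq]
    refine rank_skewMat_eq_four (by simp [pf6]; ring) fun h0 => h ?_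
    have e1 := congrFun (congrFun h0 2) 5
    have e2 := congrFun (congrFun h0 1) 4
    have e3 := congrFun (congrFun h0 0) 3
    simp [pfAdj, skewMat] at e1 e2 e3
    exact ⟨e1, e2, e3⟩

theorem isConstantRankFourPlane_planeT : IsConstantRankFourPlane planeT := by
  refine isConstantRankFourPlane_span ?_ ?_ ?_ ?_ ?_
  iterate 3 simp only [transpose_add, wedge_transpose]; abel
  · intro a b c h
    rw [planeT_eq] at h
    have e1 := congrFun (congrFun h 0) 2
    have e2 := congrFun (congrFun h 0) 3
    have e3 := congrFun (congrFun h 0) 4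
    simp [skewMat] at e1 e2 e3
    exact ⟨e1, e2, e3⟩
  · intro a b c h
    rw [planeT_eq]
    refine rank_skewMat_eq_four (by simp [pf6]) fun h0 => h ?_
    have e1 := congrFun (congrFun h0 4) 5
    have e2 := congrFun (congrFun h0 2) 5
    have e3 := congrFun (congrFun h0 2) 3
    simp [pfAdj, skewMat] at e1 e2 e3
    subst e1 e3
    simpa using e2

theorem isConstantRankFourPlane_planeP : IsConstantRankFourPlane planeP := by
  refine isConstantRankFourPlane_span ?_ ?_ ?_ ?_ ?_
  iterate 3 simp only [transpose_add, wedge_transpose]; abel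
  · intro a b c h
    rw [planeP_eq] at h
    have e1 := congrFun (congrFun h 0) 3
    have e2 := congrFun (congrFun h 0) 4
    have e3 := congrFun (congrFun h 0) 5
    simp [skewMat] at e1 e2 e3
    exact ⟨e1, e2, e3⟩
  · intro a b c h
    rw [planeP_eq]
    refine rank_skewMat_eq_four (by simp [pf6]) fun h0 => h ?_
    have e1 := congrFun (congrFun h0 4) 5
    have e2 := congrFun (congrFun h0 1) 5
    have e3 := congrFun (congrFun h0 2) 4
    simp [pfAdj, skewMat] at e1 e2 e3
    exact ⟨e1, e2, e3⟩

theorem isConstantRankFourPlane_planeFive : IsConstantRankFourPlane planeFive := by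
  refine isConstantRankFourPlane_span ?_ ?_ ?_ ?_ ?_
  iterate 3 simp only [transpose_add, wedge_transpose]; abel
  · intro a b c h
    rw [planeFive_eq] at h
    have e1 := congrFun (congrFun h 0) 3
    have e2 := congrFun (congrFun h 0) 4
    have e3 := congrFun (congrFun h 1) 4
    simp [skewMat] at e1 e2 e3
    exact ⟨e1, e2, e3⟩
  · intro a b c h
    rw [planeFive_eq]
    refine rank_skewMat_eq_four (by simp [pf6]) fun h0 => h ?_
    have e1 := congrFun (congrFun h0 4) 5
    have e2 := congrFun (congrFun h0 2) 5
    have e3 := congrFun (congrFun h0 0) 5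
    simp [pfAdj, skewMat] at e1 e2 e3
    subst e1 e3
    simpa using e2

theorem isConstantRankFourPlane_standardPlane (i : PlaneType) :
    IsConstantRankFourPlane (standardPlane i) := by
  cases i
  · exact isConstantRankFourPlane_planeG
  · exact isConstantRankFourPlane_planeT
  · exact isConstantRankFourPlane_planeP
  · exact isConstantRankFourPlane_planeFive

/-! ### The group action and recognition of the standard planes -/

theorem pglEquivalent_iff {π π' : Submodule ℂ Mat6} :
    PGLEquivalent π π' ↔ ∃ g : GL (Fin 6) ℂ, π.map (congruence g) = π' := by
  constructor
  · rintro ⟨g, hg⟩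
    obtain ⟨g, rfl⟩ := QuotientGroup.mk_surjective g
    exact ⟨g, hg⟩
  · rintro ⟨g, hg⟩
    exact ⟨QuotientGroup.mk g, hg⟩

theorem PGLEquivalent.symm {π π' : Submodule ℂ Mat6} (h : PGLEquivalent π π') :
    PGLEquivalent π' π := by
  obtain ⟨g, rfl⟩ := h
  refine ⟨g⁻¹, ?_⟩
  have := congrFun (pglAction.map_mul g⁻¹ g) π
  rw [inv_mul_cancel, map_one] at this
  exact this.symm

theorem PGLEquivalent.trans {π π' π'' : Submodule ℂ Mat6} (h : PGLEquivalent π π')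
    (h' : PGLEquivalent π' π'') : PGLEquivalent π π'' := by
  obtain ⟨g, rfl⟩ := h
  obtain ⟨k, rfl⟩ := h'
  exact ⟨k * g, congrFun (pglAction.map_mul k g) π⟩

theorem exists_gl_congruence_wedge {b : Fin 6 → Fin 6 → ℂ} (hb : LinearIndependent ℂ b) :
    ∃ g : GL (Fin 6) ℂ, ∀ i j, congruence g (wedge i j) = vw (b i) (b j) := by
  obtain ⟨u, hu⟩ := (Matrix.isUnit_transpose _).2 (isUnit_of_linearIndependent hb)
  refine ⟨u, fun i j => ?_⟩
  change (u : Mat6) * wedge i j * (u : Mat6).transpose = _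
  rw [hu]
  ext k l
  simp [wedge, vw_apply, mul_sub, sub_mul, Matrix.mul_apply,
    Matrix.single_apply, ite_and]

/-- Congruence is injective and both spaces have dimension three, so it is enough that the three
generators land in `π`. To recognise a standard plane it therefore suffices to exhibit a frame with
three memberships. -/
theorem pglEquivalent_span {π : Submodule ℂ Mat6} (hπ : IsConstantRankFourPlane π)
    {X Y Z : Mat6} (h : IsConstantRankFourPlane (Submodule.span ℂ {X, Y, Z}))
    (g : GL (Fin 6) ℂ) (hX : congruence g X ∈ π) (hY : congruence g Y ∈ π)
    (hZ : congruence g Z ∈ π) : PGLEquivalent π (Submodule.span ℂ {X, Y, Z}) := by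
  refine PGLEquivalent.symm (pglEquivalent_iff.2 ⟨g, ?_⟩)
  have hinj : Function.Injective (congruence g) := by
    intro M N hMN
    change g.val * M * g.val.transpose = g.val * N * g.val.transpose at hMN
    have hu : IsUnit g.val.transpose := (Matrix.isUnit_transpose _).2 g.isUnit
    exact g.isUnit.mul_left_cancel (hu.mul_right_cancel hMN)
  refine Submodule.eq_of_le_of_finrank_eq ?_ ?_
  · rw [Submodule.map_span_le]
    rintro M (rfl | rfl | rfl) <;> assumption
  · rw [← (Submodule.equivMapOfInjective _ hinj _).finrank_eq, h.finrank_eq, hπ.finrank_eq]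

section Recognition

variable {π : Submodule ℂ Mat6} {b : Fin 6 → Fin 6 → ℂ}

theorem pglEquivalent_planeG (hπ : IsConstantRankFourPlane π) (hb : LinearIndependent ℂ b)
    (h1 : vw (b 0) (b 4) - vw (b 1) (b 3) ∈ π) (h2 : vw (b 0) (b 5) - vw (b 2) (b 3) ∈ π)
    (h3 : vw (b 1) (b 5) - vw (b 2) (b 4) ∈ π) : PGLEquivalent π planeG := by
  obtain ⟨g, hg⟩ := exists_gl_congruence_wedge hb
  exact pglEquivalent_span hπ isConstantRankFourPlane_planeG g (by simpa [hg] using h1)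
    (by simpa [hg] using h2) (by simpa [hg] using h3)

theorem pglEquivalent_planeT (hπ : IsConstantRankFourPlane π) (hb : LinearIndependent ℂ b)
    (h1 : vw (b 0) (b 2) + vw (b 1) (b 3) ∈ π) (h2 : vw (b 0) (b 3) + vw (b 1) (b 4) ∈ π)
    (h3 : vw (b 0) (b 4) + vw (b 1) (b 5) ∈ π) : PGLEquivalent π planeT := by
  obtain ⟨g, hg⟩ := exists_gl_congruence_wedge hb
  exact pglEquivalent_span hπ isConstantRankFourPlane_planeT g (by simpa [hg] using h1)
    (by simpa [hg] using h2) (by simpa [hg] using h3)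

theorem pglEquivalent_planeP (hπ : IsConstantRankFourPlane π) (hb : LinearIndependent ℂ b)
    (h1 : vw (b 0) (b 3) + vw (b 1) (b 2) ∈ π) (h2 : vw (b 0) (b 4) + vw (b 2) (b 3) ∈ π)
    (h3 : vw (b 0) (b 5) + vw (b 1) (b 3) ∈ π) : PGLEquivalent π planeP := by
  obtain ⟨g, hg⟩ := exists_gl_congruence_wedge hb
  exact pglEquivalent_span hπ isConstantRankFourPlane_planeP g (by simpa [hg] using h1)
    (by simpa [hg] using h2) (by simpa [hg] using h3)

theorem pglEquivalent_planeFive (hπ : IsConstantRankFourPlane π) (hb : LinearIndependent ℂ b)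
    (h1 : vw (b 0) (b 3) + vw (b 1) (b 2) ∈ π) (h2 : vw (b 0) (b 4) + vw (b 1) (b 3) ∈ π)
    (h3 : vw (b 1) (b 4) + vw (b 2) (b 3) ∈ π) : PGLEquivalent π planeFive := by
  obtain ⟨g, hg⟩ := exists_gl_congruence_wedge hb
  exact pglEquivalent_span hπ isConstantRankFourPlane_planeFive g (by simpa [hg] using h1)
    (by simpa [hg] using h2) (by simpa [hg] using h3)

end Recognition

/-! ### Changes of frame and pencils of constant rank four -/

theorem linearIndependent_of_mem_span {b b' : Fin 6 → Fin 6 → ℂ} (hb : LinearIndependent ℂ b)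
    (h : ∀ i, b i ∈ Submodule.span ℂ (Set.range b')) : LinearIndependent ℂ b' := by
  refine linearIndependent_of_top_le_span_of_card_eq_finrank ?_ (by simp)
  rw [← hb.span_eq_top_of_card_eq_finrank (by simp)]
  exact Submodule.span_le.2 (by rintro _ ⟨i, rfl⟩; exact h i)

/-- A family is a basis if the members of a basis are given by linear combinations of it. -/
theorem linearIndependent_of_expr {b b' : Fin 6 → Fin 6 → ℂ} (hb : LinearIndependent ℂ b)
    (S : Fin 6 → Fin 6 → ℂ) (h : ∀ i, b i = ∑ j, S i j • b' j) : LinearIndependent ℂ b' := by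
  refine linearIndependent_of_mem_span hb fun i => ?_
  rw [h i]
  exact Submodule.sum_mem _ fun j _ => Submodule.smul_mem _ _ (Submodule.subset_span ⟨j, rfl⟩)

/-- Any two such decompositions of one matrix span the same four-space, which allows the frame of
the range to be replaced. -/
theorem range_vw_add_vw {x y z w : Fin 6 → ℂ} (h : (vw x y + vw z w).rank = 4) :
    LinearMap.range (vw x y + vw z w).mulVecLin = Submodule.span ℂ (Set.range ![x, y, z, w]) := by
  refine Submodule.eq_of_le_of_finrank_eq ?_ ?_
  · rintro _ ⟨v, rfl⟩
    have h : ∀ i, ![x, y, z, w] i ∈ Submodule.span ℂ (Set.range ![x, y, z, w]) :=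
      fun i => Submodule.subset_span ⟨i, rfl⟩
    rw [mulVecLin_apply, add_mulVec, vw_mulVec, vw_mulVec]
    exact add_mem
      (sub_mem (Submodule.smul_mem _ _ (h 0)) (Submodule.smul_mem _ _ (h 1)))
      (sub_mem (Submodule.smul_mem _ _ (h 2)) (Submodule.smul_mem _ _ (h 3)))
  · rw [finrank_span_eq_card (linearIndependent_of_rank_vw_add_vw h)]
    exact h

theorem exists_dual_frame {b : Fin 6 → Fin 6 → ℂ} (hb : LinearIndependent ℂ b) :
    ∃ v : Fin 6 → Fin 6 → ℂ, LinearIndependent ℂ v ∧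
      (∀ i j, v i ⬝ᵥ b j = if i = j then 1 else 0) ∧
      ∀ M : Mat6, M.transpose = -M → M = comb b
        (v 0 ⬝ᵥ M *ᵥ v 1) (v 0 ⬝ᵥ M *ᵥ v 2) (v 0 ⬝ᵥ M *ᵥ v 3) (v 0 ⬝ᵥ M *ᵥ v 4)
        (v 0 ⬝ᵥ M *ᵥ v 5) (v 1 ⬝ᵥ M *ᵥ v 2) (v 1 ⬝ᵥ M *ᵥ v 3) (v 1 ⬝ᵥ M *ᵥ v 4)
        (v 1 ⬝ᵥ M *ᵥ v 5) (v 2 ⬝ᵥ M *ᵥ v 3) (v 2 ⬝ᵥ M *ᵥ v 4) (v 2 ⬝ᵥ M *ᵥ v 5)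
        (v 3 ⬝ᵥ M *ᵥ v 4) (v 3 ⬝ᵥ M *ᵥ v 5) (v 4 ⬝ᵥ M *ᵥ v 5) := by
  obtain ⟨v, hv, hvb, -⟩ := exists_dual hb
  obtain ⟨b', -, hb', hM⟩ := exists_dual hv
  have e : b' = b := by
    have h1 : of v * (of b').transpose = 1 := by
      ext i j
      rw [Matrix.mul_apply, Matrix.one_apply]
      exact hb' i j
    have h2 : of v * (of b).transpose = 1 := by
      ext i j
      rw [Matrix.mul_apply, Matrix.one_apply]
      refine Eq.trans ?_ ((hvb j i).trans (by simp [eq_comm]))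
      exact Finset.sum_congr rfl fun k _ => mul_comm _ _
    have hu := isUnit_of_linearIndependent hv
    have h3 := transpose_injective (hu.mul_left_cancel (h1.trans h2.symm))
    exact of.injective h3
  subst e
  exact ⟨v, hv, hb', hM⟩

/-- A four by four skew block cannot have rank four when its Pfaffian vanishes. -/
theorem rank_ne_four_of_pfaffian {c01 c02 c03 c12 c13 c23 : ℂ}
    (h : c01 * c23 - c02 * c13 + c03 * c12 = 0) :
    (skewMat c01 c02 c03 0 0 c12 c13 0 0 c23 0 0 0 0 0).rank ≠ 4 := by
  intro hr
  -- The second factor is the dual of the block plus `e4 ∧ e5`, which spans the complementary zero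
  -- block. If the first factor had rank four, the second would have rank at most two and be
  -- decomposable; its entry 1 at `(4,5)` then forces the dual block to vanish by the Plücker
  -- relations, hence also the original block.
  have hmul : skewMat c01 c02 c03 0 0 c12 c13 0 0 c23 0 0 0 0 0 *
      skewMat (-c23) c13 (-c12) 0 0 (-c03) c02 0 0 (-c01) 0 0 0 0 1 = 0 := by
    ext i j
    fin_cases i <;> fin_cases j <;>
      simp [skewMat, Matrix.mul_apply, Fin.sum_univ_six] <;> first | ring1 | linear_combination h
  have hle := rank_add_rank_le_card_of_mul_eq_zero hmul
  simp at hle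
  obtain ⟨x, y, hxy⟩ := exists_eq_vw (skewMat_transpose (-c23) c13 (-c12) 0 0 (-c03) c02 0 0 (-c01)
    0 0 0 0 1) (by omega)
  have e : ∀ i j, (skewMat (-c23) c13 (-c12) 0 0 (-c03) c02 0 0 (-c01) 0 0 0 0 1) i j =
    x i * y j - y i * x j := fun i j => by rw [hxy, vw_apply]
  have e45 := e 4 5
  have k : ∀ i j, i < 4 → j < 4 →
      (skewMat (-c23) c13 (-c12) 0 0 (-c03) c02 0 0 (-c01) 0 0 0 0 1) i j = 0 := by
    intro i j hi hj
    have hi4 : (skewMat (-c23) c13 (-c12) 0 0 (-c03) c02 0 0 (-c01) 0 0 0 0 1) i 4 = 0 := by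
      fin_cases i <;> simp [skewMat] at hi ⊢
    have hj4 : (skewMat (-c23) c13 (-c12) 0 0 (-c03) c02 0 0 (-c01) 0 0 0 0 1) j 4 = 0 := by
      fin_cases j <;> simp [skewMat] at hj ⊢
    rw [e] at hi4 hj4 ⊢
    simp [skewMat] at e45
    linear_combination (x i * y j - y i * x j) * e45 + (x j * y 5 - y j * x 5) * hi4
      - (x i * y 5 - y i * x 5) * hj4
  have k01 := k 0 1 (by decide) (by decide)
  have k02 := k 0 2 (by decide) (by decide)
  have k03 := k 0 3 (by decide) (by decide)
  have k12 := k 1 2 (by decide) (by decide)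
  have k13 := k 1 3 (by decide) (by decide)
  have k23 := k 2 3 (by decide) (by decide)
  simp [skewMat] at k01 k02 k03 k12 k13 k23
  subst k01 k02 k03 k12 k13 k23
  have h0 : skewMat 0 0 0 0 0 0 0 0 0 0 0 0 0 0 0 = 0 := by
    ext i j
    fin_cases i <;> fin_cases j <;> simp [skewMat]
  rw [h0] at hr
  simp at hr

theorem exists_sq_add_mul_add_eq_zero (p q : ℂ) : ∃ t : ℂ, t * t + p * t + q = 0 := by
  obtain ⟨s, hs⟩ := IsAlgClosed.exists_pow_nat_eq (p ^ 2 / 4 - q) (n := 2) (by norm_num)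
  exact ⟨s - p / 2, by linear_combination hs⟩


/-- The pencil cannot live in the four-space that is the range of `A`: there the Pfaffian would be a
quadratic with a root. -/
theorem exists_frame_pencil {π : Submodule ℂ Mat6} (hπ : IsConstantRankFourPlane π) {A B : Mat6}
    (hA : A ∈ π) (hB : B ∈ π) (hAB : LinearIndependent ℂ ![A, B]) :
    ∃ b : Fin 6 → Fin 6 → ℂ, LinearIndependent ℂ b ∧ A = vw (b 0) (b 2) + vw (b 1) (b 3) ∧
      ∃ c01 c02 c03 c04 c05 c12 c13 c14 c15 c23 c24 c25 c34 c35 : ℂ,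
        B = comb b c01 c02 c03 c04 c05 c12 c13 c14 c15 c23 c24 c25 c34 c35 0 ∧
        ¬(c04 = 0 ∧ c14 = 0 ∧ c24 = 0 ∧ c34 = 0) := by
  have hA0 : A ≠ 0 := hAB.ne_zero 0
  have hrA := hπ.rank_eq A hA hA0
  obtain ⟨ξ, hξ⟩ := exists_mulVec_ne_zero hA0
  obtain ⟨y, z, w, hAe⟩ := exists_eq_vw_add_vw (hπ.skew A hA) hrA hξ
  generalize A *ᵥ ξ = x at hAe
  have hli := linearIndependent_of_rank_vw_add_vw (hAe ▸ hrA)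
  obtain ⟨u, hu⟩ := exists_linearIndependent_cons_of_lt_finrank hli (by simp)
  obtain ⟨u', hu'⟩ := exists_linearIndependent_cons_of_lt_finrank hu (by simp)
  have hb : LinearIndependent ℂ ![x, z, y, w, u, u'] := by
    refine linearIndependent_of_mem_span hu' fun i => ?_
    have h : ∀ i, ![x, z, y, w, u, u'] i ∈ Submodule.span ℂ (Set.range ![x, z, y, w, u, u']) :=
      fun i => Submodule.subset_span ⟨i, rfl⟩
    fin_cases i
    exacts [h 5, h 4, h 0, h 2, h 1, h 3]
  obtain ⟨b, hbe⟩ : ∃ b, b = ![x, z, y, w, u, u'] := ⟨_, rfl⟩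
  rw [← hbe] at hb
  have hAb : A = vw (b 0) (b 2) + vw (b 1) (b 3) := by rw [hAe, hbe]; rfl
  obtain ⟨c01, c02, c03, c04, c05, c12, c13, c14, c15, c23, c24, c25, c34, c35, c45, hBc⟩ :=
    exists_comb hb (hπ.skew B hB)
  have hpf : ∀ s t : ℂ, pf6 (t * c01) (s + t * c02) (t * c03) (t * c04) (t * c05) (t * c12)
      (s + t * c13) (t * c14) (t * c15) (t * c23) (t * c24) (t * c25) (t * c34) (t * c35)
      (t * c45) = 0 := by
    intro s t
    refine pf6_eq_zero hπ hb ?_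
    have := π.add_mem (π.smul_mem s hA) (π.smul_mem t hB)
    rw [hAb, hBc] at this
    convert this using 1
    simp only [comb]
    module
  -- The coefficient of `s² t` in the Pfaffian of `sA + tB` is `-c45`; a second difference in `s` at
  -- `t = 1` isolates it.
  have h45 : c45 = 0 := by
    have h1 := hpf 1 1
    have h2 := hpf 1 (-1)
    have h3 := hpf 2 1
    have h4 := hpf 0 1
    simp only [pf6] at h1 h2 h3 h4
    linear_combination -(h3 - 2 * h1 + h4) / 2
  subst h45
  by_cases h4 : c04 = 0 ∧ c14 = 0 ∧ c24 = 0 ∧ c34 = 0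
  swap
  · exact ⟨b, hb, hAb, _, _, _, _, _, _, _, _, _, _, _, _, _, _, hBc, h4⟩
  by_cases h5 : c05 = 0 ∧ c15 = 0 ∧ c25 = 0 ∧ c35 = 0
  swap
  · refine ⟨![b 0, b 1, b 2, b 3, b 5, b 4], ?_, by simpa using hAb, c01, c02, c03, c05, c04, c12,
      c13, c15, c14, c23, c25, c24, c35, c34, ?_, h5⟩
    · refine linearIndependent_of_mem_span hb fun i => ?_
      have h : ∀ i, ![b 0, b 1, b 2, b 3, b 5, b 4] i ∈
          Submodule.span ℂ (Set.range ![b 0, b 1, b 2, b 3, b 5, b 4]) :=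
        fun i => Submodule.subset_span ⟨i, rfl⟩
      fin_cases i
      exacts [h 0, h 1, h 2, h 3, h 5, h 4]
    · rw [hBc]
      simp [comb]
      abel
  exfalso
  obtain ⟨rfl, rfl, rfl, rfl⟩ := h4
  obtain ⟨rfl, rfl, rfl, rfl⟩ := h5
  -- The root is chosen so that the Pfaffian of `B - tA` on the four-space vanishes.
  obtain ⟨t, ht⟩ := exists_sq_add_mul_add_eq_zero (-(c02 + c13)) (c02 * c13 - c01 * c23 - c03 * c12)
  refine rank_ne_four_of_pfaffian (c01 := c01) (c02 := c02 - t) (c03 := c03) (c12 := c12)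
    (c13 := c13 - t) (c23 := c23) (by linear_combination -ht) ?_
  rw [← rank_congr (isUnit_of_linearIndependent hb), ← comb_eq]
  have e : comb b c01 (c02 - t) c03 0 0 c12 (c13 - t) 0 0 c23 0 0 0 0 0 = (-t) • A + B := by
    rw [hAb, hBc]
    simp only [comb]
    module
  rw [e]
  refine hπ.rank_eq _ (π.add_mem (π.smul_mem _ hA) hB) fun h0 => ?_
  have := LinearIndependent.pair_iff.1 hAB (-t) 1 (by simpa using h0)
  simp at this

/-- The vector paired with `b 4` in `B` lies in the range of `A` and is nonzero, so a normal form of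
`A` may be chosen with this vector as its first one. -/
theorem exists_adapted_frame_pencil {π : Submodule ℂ Mat6} (hπ : IsConstantRankFourPlane π)
    {A B : Mat6} (hA : A ∈ π) (hB : B ∈ π) (hAB : LinearIndependent ℂ ![A, B]) :
    ∃ b : Fin 6 → Fin 6 → ℂ, LinearIndependent ℂ b ∧ A = vw (b 0) (b 2) + vw (b 1) (b 3) ∧
      ∃ c01 c02 c03 c05 c12 c13 c15 c23 c25 c35 c45 : ℂ,
        B = comb b c01 c02 c03 1 c05 c12 c13 0 c15 c23 0 c25 0 c35 c45 := by
  obtain ⟨b, hb, hAb, c01, c02, c03, c04, c05, c12, c13, c14, c15, c23, c24, c25, c34, c35, hBb,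
    hne⟩ := exists_frame_pencil hπ hA hB hAB
  have hA0 : A ≠ 0 := hAB.ne_zero 0
  have hrA := hπ.rank_eq A hA hA0
  obtain ⟨v, -, hv, -⟩ := exists_dual_frame hb
  have hv' : ∀ i j, b i ⬝ᵥ v j = if i = j then 1 else 0 := by
    intro i j
    rw [dotProduct_comm, hv]
    simp [eq_comm]
  set p := c04 • b 0 + c14 • b 1 + c24 • b 2 + c34 • b 3 with hp
  have hp0 : p ≠ 0 := by
    intro h0
    apply hne
    have e : ∀ i, v i ⬝ᵥ p = 0 := fun i => by rw [h0]; simp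
    have e0 := e 0
    have e1 := e 1
    have e2 := e 2
    have e3 := e 3
    simp [hp, hv] at e0 e1 e2 e3
    exact ⟨e0, e1, e2, e3⟩
  obtain ⟨ξ, hξ⟩ : ∃ ξ, A *ᵥ ξ = p := by
    refine ⟨c04 • v 2 + c14 • v 3 - c24 • v 0 - c34 • v 1, ?_⟩
    rw [hAb, add_mulVec, vw_mulVec, vw_mulVec]
    simp [dotProduct_add, dotProduct_sub, hv', hp]
    module
  obtain ⟨y, z, w, hAe⟩ := exists_eq_vw_add_vw (hπ.skew A hA) hrA (hξ.symm ▸ hp0)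
  rw [hξ] at hAe
  have hspan : Submodule.span ℂ (Set.range ![p, y, z, w])
      = Submodule.span ℂ (Set.range ![b 0, b 2, b 1, b 3]) := by
    rw [← range_vw_add_vw (hAe ▸ hrA), ← range_vw_add_vw (hAb ▸ hrA), ← hAe, ← hAb]
  have hmem : ∀ i, ![b 0, b 2, b 1, b 3] i ∈ Submodule.span ℂ (Set.range ![p, y, z, w]) := by
    intro i
    rw [hspan]
    exact Submodule.subset_span ⟨i, rfl⟩
  obtain ⟨d, hd⟩ : ∃ d, d = ![p, z, y, w, b 4, b 5] := ⟨_, rfl⟩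
  have hle : Submodule.span ℂ (Set.range ![p, y, z, w]) ≤ Submodule.span ℂ (Set.range d) := by
    have h : ∀ i, d i ∈ Submodule.span ℂ (Set.range d) :=
      fun i => Submodule.subset_span ⟨i, rfl⟩
    refine Submodule.span_le.2 ?_
    rintro _ ⟨i, rfl⟩
    rw [hd] at h ⊢
    fin_cases i
    exacts [h 0, h 2, h 1, h 3]
  have hdl : LinearIndependent ℂ d := by
    have h : ∀ i, d i ∈ Submodule.span ℂ (Set.range d) :=
      fun i => Submodule.subset_span ⟨i, rfl⟩
    refine linearIndependent_of_mem_span hb fun i => ?_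
    fin_cases i
    · exact hle (hmem 0)
    · exact hle (hmem 2)
    · exact hle (hmem 1)
    · exact hle (hmem 3)
    · simpa [hd] using h 4
    · simpa [hd] using h 5
  obtain ⟨u, -, hu, hM⟩ := exists_dual_frame hdl
  -- The functional `u 4` is dual to `b 4` in the new frame; as the four-space is unchanged, it is
  -- dual to `b 4` in the old frame too, so `B *ᵥ u 4` is still `p`.
  have hkill : ∀ x ∈ Submodule.span ℂ (Set.range ![p, y, z, w]), x ⬝ᵥ u 4 = 0 := by
    intro x hx
    induction hx using Submodule.span_induction with
    | mem x h =>
      obtain ⟨i, rfl⟩ := h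
      have h0 := hu 4 0
      have h1 := hu 4 1
      have h2 := hu 4 2
      have h3 := hu 4 3
      simp [hd] at h0 h1 h2 h3
      rw [dotProduct_comm]
      fin_cases i
      exacts [h0, h2, h1, h3]
    | zero => simp
    | add x y _ _ hx hy => rw [add_dotProduct, hx, hy, add_zero]
    | smul a x _ hx => rw [smul_dotProduct, hx, smul_zero]
  have k0 := hkill _ (hmem 0)
  have k2 := hkill _ (hmem 1)
  have k1 := hkill _ (hmem 2)
  have k3 := hkill _ (hmem 3)
  have k4 : b 4 ⬝ᵥ u 4 = 1 := by
    have := hu 4 4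
    rw [dotProduct_comm]
    simpa [hd] using this
  have k5 : b 5 ⬝ᵥ u 4 = 0 := by
    have := hu 4 5
    rw [dotProduct_comm]
    simpa [hd] using this
  simp at k0 k1 k2 k3
  have hBu : B *ᵥ u 4 = d 0 := by
    rw [hBb, hd]
    simp [comb, add_mulVec, smul_mulVec, vw_mulVec, k0, k1, k2, k3, k4, k5, hp]
  have hBe := hM B (hπ.skew B hB)
  simp only [hBu, hu] at hBe
  simp at hBe
  exact ⟨d, hdl, by rw [hAe, hd]; rfl, _, _, _, _, _, _, _, _, _, _, _, hBe⟩

/-- A pencil of matrices of rank four is of one of two types. -/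
theorem pencil_type {π : Submodule ℂ Mat6} (hπ : IsConstantRankFourPlane π)
    {A B : Mat6} (hA : A ∈ π) (hB : B ∈ π) (hAB : LinearIndependent ℂ ![A, B]) :
    (∃ b : Fin 6 → Fin 6 → ℂ, LinearIndependent ℂ b ∧ A = vw (b 0) (b 2) + vw (b 1) (b 3) ∧
      B = vw (b 0) (b 4) + vw (b 1) (b 5)) ∨
    (∃ b : Fin 6 → Fin 6 → ℂ, LinearIndependent ℂ b ∧ A = vw (b 0) (b 2) + vw (b 1) (b 3) ∧
      ∃ c : ℂ, B = c • A + (vw (b 0) (b 3) + vw (b 1) (b 4))) := by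
  obtain ⟨b, hb, hAb, c01, c02, c03, c05, c12, c13, c15, c23, c25, c35, c45, hBb⟩ :=
    exists_adapted_frame_pencil hπ hA hB hAB
  have hpf : ∀ s t : ℂ, pf6 (t * c01) (s + t * c02) (t * c03) (t * 1) (t * c05) (t * c12)
      (s + t * c13) (t * 0) (t * c15) (t * c23) (t * 0) (t * c25) (t * 0) (t * c35)
      (t * c45) = 0 := by
    intro s t
    refine pf6_eq_zero hπ hb ?_
    have := π.add_mem (π.smul_mem s hA) (π.smul_mem t hB)
    rw [hAb, hBb] at this
    convert this using 1
    simp only [comb]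
    module
  have h1 := hpf 1 1
  have h2 := hpf 1 (-1)
  have h3 := hpf 2 1
  have h4 := hpf 0 1
  simp only [pf6] at h1 h2 h3 h4
  have h45 : c45 = 0 := by linear_combination -(h3 - 2 * h1 + h4) / 2
  subst h45
  have h25 : c25 = 0 := by linear_combination h1 - h4
  subst h25
  have hrel : c12 * c35 + c15 * c23 = 0 := by linear_combination -h4
  -- With `d` absorbing every term in `b 0`, `B = b0∧d + c12 b1∧b2 + c13 b1∧b3 + c23 b2∧b3 + (c15 b1
  -- + c35 b3)∧b5`. If `c15 b1 + c35 b3` is nonzero, `hrel` lets the `b1∧b2` and `b2∧b3` terms be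
  -- divided by it, giving the first type. Otherwise `B - c13 A = b0∧(d - c13 b2) + (c12 b1 - c23
  -- b3)∧b2`: the second type, unless the last factor vanishes and the rank drops to two.
  obtain ⟨d, hd⟩ : ∃ d, d = b 4 + c05 • b 5 + c01 • b 1 + c02 • b 2 + c03 • b 3 := ⟨_, rfl⟩
  by_cases h15 : c15 = 0
  · by_cases h35 : c35 = 0
    · subst h15 h35
      right
      by_cases h12 : c12 = 0
      · by_cases h23 : c23 = 0
        · exfalso
          have e : (-c13) • A + B = vw (b 0) (d - c13 • b 2) := by
            rw [hAb, hBb, h12, h23, hd]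
            ext i j
            simp [comb, vw_apply]
            ring
          have hr := hπ.rank_eq _ (π.add_mem (π.smul_mem (-c13) hA) hB) fun h0 => by
            have := LinearIndependent.pair_iff.1 hAB (-c13) 1 (by simpa using h0)
            simp at this
          rw [e] at hr
          have := rank_vw_le (b 0) (d - c13 • b 2)
          omega
        · refine ⟨![-c23 • b 3, b 0, c23⁻¹ • b 1, b 2, d - c13 • b 2, b 5], ?_, ?_, c13, ?_⟩
          -- The rows give the old frame in terms of the new one; later changes of frame are
          -- inverted in the same way.
          · refine linearIndependent_of_expr hb !![0, 1, 0, 0, 0, 0; 0, 0, c23, 0, 0, 0;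
              0, 0, 0, 1, 0, 0; -c23⁻¹, 0, 0, 0, 0, 0;
              c03 * c23⁻¹, 0, -c01 * c23, c13 - c02, 1, -c05; 0, 0, 0, 0, 0, 1] ?_
            intro i
            fin_cases i <;> simp [Fin.sum_univ_six, hd, smul_smul, h23]
            ext k
            simp
            field_simp
            ring
          · rw [hAb]
            ext i j
            simp [vw_apply]
            field_simp
            ring
          · rw [hAb, hBb, h12, hd]
            ext i j
            simp [comb, vw_apply]
            ring
      · refine ⟨![c12 • b 1 - c23 • b 3, b 0, c12⁻¹ • b 3, b 2, d - c13 • b 2, b 5], ?_, ?_,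
          c13, ?_⟩
        · refine linearIndependent_of_expr hb !![0, 1, 0, 0, 0, 0; c12⁻¹, 0, c23, 0, 0, 0;
              0, 0, 0, 1, 0, 0; 0, 0, c12, 0, 0, 0;
              -c01 * c12⁻¹, 0, -c01 * c23 - c03 * c12, c13 - c02, 1, -c05; 0, 0, 0, 0, 0, 1] ?_
          intro i
          fin_cases i <;> simp [Fin.sum_univ_six, hd, smul_smul, h12]
          all_goals
            ext k
            simp
            field_simp
            ring
        · rw [hAb]
          ext i j
          simp [vw_apply]
          field_simp
          ring
        · rw [hAb, hBb, hd]
          ext i j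
          simp [comb, vw_apply]
          ring
    · left
      subst h15
      have h12 : c12 = 0 := by simpa [h35] using hrel
      subst h12
      refine ⟨![b 0, c35 • b 3, b 2, -c35⁻¹ • b 1, d, b 5 - (c23 / c35) • b 2
        - (c13 / c35) • b 1], ?_, ?_, ?_⟩
      · refine linearIndependent_of_expr hb !![1, 0, 0, 0, 0, 0; 0, 0, 0, -c35, 0, 0;
              0, 0, 1, 0, 0, 0; 0, c35⁻¹, 0, 0, 0, 0;
              0, -c03 / c35, -c02 - c05 * (c23 / c35), c01 * c35 + c05 * c13, 1, -c05;
              0, 0, c23 / c35, -c13, 0, 1] ?_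
        intro i
        fin_cases i <;> simp [Fin.sum_univ_six, hd, smul_smul, h35]
        all_goals
          ext k
          simp
          field_simp
          ring
      · rw [hAb]
        ext i j
        simp [vw_apply]
        field_simp
        ring
      · rw [hBb, hd]
        ext i j
        simp [comb, vw_apply]
        field_simp
        ring
  · left
    refine ⟨![b 0, c15 • b 1 + c35 • b 3, b 2, c15⁻¹ • b 3, d, b 5 + (c12 / c15) • b 2
        + (c13 / c15) • b 3], ?_, ?_, ?_⟩
    · refine linearIndependent_of_expr hb !![1, 0, 0, 0, 0, 0; 0, c15⁻¹, 0, -c35, 0, 0;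
              0, 0, 1, 0, 0, 0; 0, 0, 0, c15, 0, 0;
              0, -c01 / c15, -c02 + c05 * (c12 / c15), c01 * c35 - c03 * c15 + c05 * c13, 1, -c05;
              0, 0, -c12 / c15, -c13, 0, 1] ?_
      intro i
      fin_cases i <;> simp [Fin.sum_univ_six, hd, smul_smul, h15]
      all_goals
        ext k
        simp
        field_simp
        ring
    · rw [hAb]
      ext i j
      simp [vw_apply]
      field_simp
      ring
    · rw [hBb, hd]
      have h23 : c23 = -(c12 * c35) / c15 := by
        field_simp
        linear_combination hrel
      rw [h23]
      ext i j
      simp [comb, vw_apply]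
      field_simp
      ring

/-! ### Planes containing a generic pencil -/

theorem exists_coords {b : Fin 6 → Fin 6 → ℂ} (hb : LinearIndependent ℂ b) (x : Fin 6 → ℂ) :
    ∃ r0 r1 r2 r3 r4 r5 : ℂ,
      x = r0 • b 0 + r1 • b 1 + r2 • b 2 + r3 • b 3 + r4 • b 4 + r5 • b 5 := by
  have h : x ∈ Submodule.span ℂ (Set.range b) := by
    rw [hb.span_eq_top_of_card_eq_finrank (by simp)]
    trivial
  obtain ⟨r, hr⟩ := (Submodule.mem_span_range_iff_exists_fun ℂ).1 h
  exact ⟨r 0, r 1, r 2, r 3, r 4, r 5, by rw [← hr, Fin.sum_univ_six]⟩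

section GenericPencil

variable {π : Submodule ℂ Mat6} {b : Fin 6 → Fin 6 → ℂ}

/-- The Pfaffian of `sA + tB + C`, expanded in `s` and `t`, gives just the relations under which `ρ`
and `σ` are absorbed by correcting `b 2, …, b 5` with multiples of `b 0` and `b 1`. -/
theorem pglEquivalent_planeG_of_pencil (hπ : IsConstantRankFourPlane π)
    (hb : LinearIndependent ℂ b)
    (hA : vw (b 0) (b 2) + vw (b 1) (b 3) ∈ π) (hB : vw (b 0) (b 4) + vw (b 1) (b 5) ∈ π)
    {ρ σ : Fin 6 → ℂ}
    (hC : vw (b 2) (b 5) + vw (b 3) (b 4) + vw (b 0) ρ + vw (b 1) σ ∈ π) :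
    PGLEquivalent π planeG := by
  obtain ⟨r0, r1, r2, r3, r4, r5, rfl⟩ := exists_coords hb ρ
  obtain ⟨s0, s1, s2, s3, s4, s5, rfl⟩ := exists_coords hb σ
  have hpf : ∀ s t : ℂ, pf6 (r1 - s0) (r2 + s) r3 (r4 + t) r5 s2 (s3 + s) s4 (s5 + t) 0 0 1 1 0 0
      = 0 := by
    intro s t
    refine pf6_eq_zero hπ hb ?_
    have := π.add_mem (π.add_mem (π.smul_mem s hA) (π.smul_mem t hB)) hC
    convert this using 1
    ext i j
    simp [comb, vw_apply]
    ring
  have h00 := hpf 0 0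
  have h10 := hpf 1 0
  have h01 := hpf 0 1
  simp only [pf6] at h00 h10 h01
  have e1 : s3 = r2 := by linear_combination h01 - h00
  have e2 : s5 = r4 := by linear_combination -h10 + h00
  subst e1 e2
  have e3 : r1 = s0 - s2 * r5 + r3 * s4 := by linear_combination h00
  subst e3
  refine pglEquivalent_planeG (b := ![b 1, b 2 + r5 • b 0 + s5 • b 1, b 4 - r3 • b 0 - s3 • b 1,
    b 0, b 3 + s5 • b 0 + s4 • b 1, b 5 - s3 • b 0 - s2 • b 1]) hπ ?_ ?_ ?_ ?_
  · refine linearIndependent_of_expr hb !![0, 0, 0, 1, 0, 0; 1, 0, 0, 0, 0, 0;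
      -s5, 1, 0, -r5, 0, 0; -s4, 0, 0, -s5, 1, 0; s3, 0, 1, r3, 0, 0; s2, 0, 0, s3, 0, 1] ?_
    intro i
    fin_cases i <;> simp [Fin.sum_univ_six]
    all_goals
      ext k
      simp
      ring
  · convert hA using 1
    ext i j
    simp [vw_apply]
    ring
  · convert hB using 1
    ext i j
    simp [vw_apply]
    ring
  · convert hC using 1
    ext i j
    simp [vw_apply]
    ring

theorem pglEquivalent_planeP_of_pencil (hπ : IsConstantRankFourPlane π)
    (hb : LinearIndependent ℂ b)
    (hA : vw (b 0) (b 2) + vw (b 1) (b 3) ∈ π) (hB : vw (b 0) (b 4) + vw (b 1) (b 5) ∈ π)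
    {ρ σ : Fin 6 → ℂ} (hC : vw (b 2) (b 4) + vw (b 0) ρ + vw (b 1) σ ∈ π) :
    PGLEquivalent π planeP := by
  obtain ⟨r0, r1, r2, r3, r4, r5, rfl⟩ := exists_coords hb ρ
  obtain ⟨s0, s1, s2, s3, s4, s5, rfl⟩ := exists_coords hb σ
  have hpf : ∀ s t : ℂ, pf6 (r1 - s0) (r2 + s) r3 (r4 + t) r5 s2 (s3 + s) s4 (s5 + t) 0 1 0 0 0 0
      = 0 := by
    intro s t
    refine pf6_eq_zero hπ hb ?_
    have := π.add_mem (π.add_mem (π.smul_mem s hA) (π.smul_mem t hB)) hC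
    convert this using 1
    ext i j
    simp [comb, vw_apply]
    ring
  have h00 := hpf 0 0
  have h10 := hpf 1 0
  have h01 := hpf 0 1
  simp only [pf6] at h00 h10 h01
  have e1 : r3 = 0 := by linear_combination h01 - h00
  have e2 : r5 = 0 := by linear_combination -h10 + h00
  subst e1 e2
  -- Completing the product turns `C`, modulo `A` and `B`, into `y∧y' + g b0∧b1`. The coefficient
  -- `g` is nonzero because `y∧y'` alone would be a member of rank two.
  obtain ⟨g, hg⟩ : ∃ g, g = r1 - s0 - ((r4 - s5) * (-s2) - s4 * (s3 - r2)) := ⟨_, rfl⟩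
  obtain ⟨y, hy⟩ : ∃ y, y = b 2 + (r4 - s5) • b 0 + s4 • b 1 := ⟨_, rfl⟩
  obtain ⟨y', hy'⟩ : ∃ y', y' = b 4 + (s3 - r2) • b 0 - s2 • b 1 := ⟨_, rfl⟩
  have hC' : g • vw (b 0) (b 1) + vw y y' ∈ π := by
    have := π.sub_mem (π.sub_mem hC (π.smul_mem s3 hA)) (π.smul_mem s5 hB)
    convert this using 1
    rw [hg, hy, hy']
    ext i j
    simp [vw_apply]
    ring
  have hg0 : g ≠ 0 := by
    intro h0
    rw [h0, zero_smul, zero_add] at hC'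
    have hne : vw y y' ≠ 0 := by
      intro h
      have hx : comb b ((r4 - s5) * (-s2) - s4 * (s3 - r2)) (r2 - s3) 0 (r4 - s5) 0 s2 0 s4 0 0 1 0
          0 0 0 = 0 := by
        rw [← h, hy, hy']
        ext i j
        simp [comb, vw_apply]
        ring
      rw [comb_eq] at hx
      have hu := isUnit_of_linearIndependent hb
      have hu' := (Matrix.isUnit_transpose _).2 hu
      have hx' := hu'.mul_left_cancel ((hu.mul_right_cancel (hx.trans (zero_mul _).symm)).trans
        (mul_zero _).symm)
      have := congrFun (congrFun hx' 2) 4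
      simp [skewMat] at this
    have hr := hπ.rank_eq _ hC' hne
    have := rank_vw_le y y'
    omega
  refine pglEquivalent_planeP (b := ![-g • b 1, y, y', b 0, g⁻¹ • (b 5 - s2 • b 0),
    g⁻¹ • (b 3 + s4 • b 0)]) hπ ?_ ?_ ?_ ?_
  · refine linearIndependent_of_expr hb !![0, 0, 0, 1, 0, 0; -g⁻¹, 0, 0, 0, 0, 0;
      s4 / g, 1, 0, -(r4 - s5), 0, 0; 0, 0, 0, -s4, 0, g; -s2 / g, 0, 1, -(s3 - r2), 0, 0;
      0, 0, 0, s2, g, 0] ?_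
    intro i
    fin_cases i <;> simp [Fin.sum_univ_six, hy, hy', smul_smul, hg0]
    all_goals
      ext k
      simp
      field_simp
      ring
  · convert hC' using 1
    ext i j
    simp [vw_apply]
    ring
  · convert π.neg_mem hB using 1
    ext i j
    simp [vw_apply, hy']
    field_simp
    ring
  · convert π.neg_mem hA using 1
    ext i j
    simp [vw_apply, hy]
    field_simp
    ring

end GenericPencil

/-- A nonzero binary form over `ℂ` has a linear factor; a vanishing top coefficient is the root at
infinity. The cubic version below is the same. -/
theorem exists_quadratic_factor {f0 f1 f2 : ℂ} (h : ¬(f0 = 0 ∧ f1 = 0 ∧ f2 = 0)) :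
    ∃ l m g0 g1 : ℂ, ¬(l = 0 ∧ m = 0) ∧ ¬(g0 = 0 ∧ g1 = 0) ∧
      f0 = l * g0 ∧ f1 = l * g1 + m * g0 ∧ f2 = m * g1 := by
  by_cases h2 : f2 = 0
  · exact ⟨1, 0, f0, f1, by simp, fun h' => h ⟨h'.1, h'.2, h2⟩, by simp, by simp, by simp [h2]⟩
  · obtain ⟨t, ht⟩ := exists_sq_add_mul_add_eq_zero (f1 / f2) (f0 / f2)
    field_simp at ht
    refine ⟨-t, 1, f1 + t * f2, f2, by simp, fun h' => h2 h'.2, ?_, by ring, by ring⟩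
    linear_combination ht

theorem exists_cubic_root (p q r : ℂ) : ∃ t : ℂ, t ^ 3 + p * t ^ 2 + q * t + r = 0 := by
  have hdeg : (Polynomial.X ^ 3 + Polynomial.C p * Polynomial.X ^ 2 + Polynomial.C q * Polynomial.X
      + Polynomial.C r : Polynomial ℂ).degree = 3 := by compute_degree!
  obtain ⟨t, ht⟩ := IsAlgClosed.exists_root _ (by rw [hdeg]; decide)
  exact ⟨t, by simpa using ht⟩

theorem exists_cubic_factor {f0 f1 f2 f3 : ℂ} (h : ¬(f0 = 0 ∧ f1 = 0 ∧ f2 = 0 ∧ f3 = 0)) :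
    ∃ l m g0 g1 g2 : ℂ, ¬(l = 0 ∧ m = 0) ∧ ¬(g0 = 0 ∧ g1 = 0 ∧ g2 = 0) ∧
      f0 = l * g0 ∧ f1 = l * g1 + m * g0 ∧ f2 = l * g2 + m * g1 ∧ f3 = m * g2 := by
  by_cases h3 : f3 = 0
  · exact ⟨1, 0, f0, f1, f2, by simp, fun h' => h ⟨h'.1, h'.2.1, h'.2.2, h3⟩, by simp, by simp,
      by simp, by simp [h3]⟩
  · obtain ⟨t, ht⟩ := exists_cubic_root (f2 / f3) (f1 / f3) (f0 / f3)
    field_simp at ht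
    refine ⟨-t, 1, f1 + t * (f2 + t * f3), f2 + t * f3, f3, by simp, fun h' => h3 h'.2.2, ?_,
      by ring, by ring, by ring⟩
    linear_combination ht

/-- The normal form of a pencil of `3 × 4` matrices of constant rank three. -/
theorem exists_kronecker_chain {α β : (Fin 3 → ℂ) →ₗ[ℂ] (Fin 4 → ℂ)}
    (h : ∀ (w : Fin 3 → ℂ) (l m : ℂ), l • α w + m • β w = 0 → ¬(l = 0 ∧ m = 0) → w = 0) :
    ∃ w0 w1 w2 : Fin 3 → ℂ, β w0 = α w1 ∧ β w1 = α w2 ∧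
      LinearIndependent ℂ ![α w0, α w1, α w2, β w2] := by
  have hα : ∀ w, α w = 0 → w = 0 := fun w hw => h w 1 0 (by simp [hw]) (by simp)
  let E := Fin 3 → ℂ
  -- A kernel vector of `f` is exactly a chain `β w0 = α w1`, `β w1 = α w2`; it exists because `f`
  -- goes from dimension nine to dimension eight.
  let f : (E × E × E) →ₗ[ℂ] ((Fin 4 → ℂ) × (Fin 4 → ℂ)) :=
    (β ∘ₗ LinearMap.fst ℂ E (E × E)
      - α ∘ₗ LinearMap.fst ℂ E E ∘ₗ LinearMap.snd ℂ E (E × E)).prod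
    (β ∘ₗ LinearMap.fst ℂ E E ∘ₗ LinearMap.snd ℂ E (E × E)
      - α ∘ₗ LinearMap.snd ℂ E E ∘ₗ LinearMap.snd ℂ E (E × E))
  have hker : LinearMap.ker f ≠ ⊥ := LinearMap.ker_ne_bot_of_finrank_lt (by simp [E])
  obtain ⟨⟨w0, w1, w2⟩, hw, hne⟩ := Submodule.exists_mem_ne_zero_of_ne_bot hker
  have h1 : β w0 = α w1 := by
    have := congrArg Prod.fst (LinearMap.mem_ker.1 hw)
    exact sub_eq_zero.1 this
  have h2 : β w1 = α w2 := by
    have := congrArg Prod.snd (LinearMap.mem_ker.1 hw)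
    exact sub_eq_zero.1 this
  have h0 : w0 ≠ 0 := by
    rintro rfl
    have hw1 : w1 = 0 := hα _ (by rw [← h1, map_zero])
    subst hw1
    have hw2 : w2 = 0 := hα _ (by rw [← h2, map_zero])
    subst hw2
    exact hne rfl
  refine ⟨w0, w1, w2, h1, h2, ?_⟩
  rw [Fintype.linearIndependent_iff]
  intro c hc
  simp [Fin.sum_univ_four] at hc
  suffices hs : c 0 = 0 ∧ c 1 = 0 ∧ c 2 = 0 ∧ c 3 = 0 by
    obtain ⟨c0, c1, c2, c3⟩ := hs
    intro i
    fin_cases i <;> assumption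
  by_contra hcne
  -- A relation is read as a binary cubic in which `α`, `β` play the variables. Each linear factor
  -- can be cancelled by the injectivity of `l α + m β`; after three cancellations only `w0 = 0`
  -- remains.
  obtain ⟨l, m, g0, g1, g2, hlm, hg, e0, e1, e2, e3⟩ := exists_cubic_factor hcne
  have k1 : g0 • w0 + g1 • w1 + g2 • w2 = 0 := by
    refine h _ l m ?_ hlm
    rw [← hc, e0, e1, e2, e3]
    simp only [map_add, map_smul, h1, h2]
    module
  obtain ⟨l', m', f0, f1, hlm', hf, e0', e1', e2'⟩ := exists_quadratic_factor hg
  have k2 : f0 • w0 + f1 • w1 = 0 := by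
    refine h _ l' m' ?_ hlm'
    rw [← map_zero α, ← k1, e0', e1', e2']
    simp only [map_add, map_smul, h1, h2]
    module
  refine h0 (h w0 f0 f1 ?_ hf)
  rw [← map_zero α, ← k2]
  simp only [map_add, map_smul, h1]

section GenericPencil

variable {π : Submodule ℂ Mat6} {b : Fin 6 → Fin 6 → ℂ}

theorem pglEquivalent_planeT_of_pencil (hπ : IsConstantRankFourPlane π)
    (hb : LinearIndependent ℂ b)
    (hA : vw (b 0) (b 2) + vw (b 1) (b 3) ∈ π) (hB : vw (b 0) (b 4) + vw (b 1) (b 5) ∈ π)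
    {ρ σ : Fin 6 → ℂ} (hC : vw (b 0) ρ + vw (b 1) σ ∈ π)
    (hli : ∀ s t u : ℂ, s • (vw (b 0) (b 2) + vw (b 1) (b 3)) + t • (vw (b 0) (b 4) + vw (b 1) (b 5))
      + u • (vw (b 0) ρ + vw (b 1) σ) = 0 → s = 0 ∧ t = 0 ∧ u = 0) :
    PGLEquivalent π planeT := by
  obtain ⟨r0, r1, r2, r3, r4, r5, rfl⟩ := exists_coords hb ρ
  obtain ⟨s0, s1, s2, s3, s4, s5, rfl⟩ := exists_coords hb σ
  -- For the member `w 0 • A + w 1 • B + w 2 • C`, the `b 2, …, b 5` coordinates of the vectors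
  -- wedged with `b 0` and `b 1` are `α w` and `β w`. If some `l α w + m β w` vanished, that member
  -- would be decomposable.
  obtain ⟨α, hα⟩ : ∃ α : (Fin 3 → ℂ) →ₗ[ℂ] (Fin 4 → ℂ), ∀ w,
      α w = ![w 0 + w 2 * r2, w 2 * r3, w 1 + w 2 * r4, w 2 * r5] := by
    refine ⟨(!![1, 0, r2; 0, 0, r3; 0, 1, r4; 0, 0, r5]).mulVecLin, fun w => ?_⟩
    ext i
    fin_cases i <;> simp [Matrix.mulVec, dotProduct, Fin.sum_univ_three, mul_comm]
  obtain ⟨β, hβ⟩ : ∃ β : (Fin 3 → ℂ) →ₗ[ℂ] (Fin 4 → ℂ), ∀ w,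
      β w = ![w 2 * s2, w 0 + w 2 * s3, w 2 * s4, w 1 + w 2 * s5] := by
    refine ⟨(!![0, 0, s2; 1, 0, s3; 0, 0, s4; 0, 1, s5]).mulVecLin, fun w => ?_⟩
    ext i
    fin_cases i <;> simp [Matrix.mulVec, dotProduct, Fin.sum_univ_three, mul_comm]
  obtain ⟨Q, hQ⟩ : ∃ Q : (Fin 4 → ℂ) → (Fin 6 → ℂ), ∀ x,
      Q x = x 0 • b 2 + x 1 • b 3 + x 2 • b 4 + x 3 • b 5 := ⟨_, fun _ => rfl⟩
  have hmem : ∀ w : Fin 3 → ℂ, vw (b 0) (Q (α w)) + vw (b 1) (Q (β w))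
      + (w 2 * (r1 - s0)) • vw (b 0) (b 1) ∈ π := by
    intro w
    have := π.add_mem (π.add_mem (π.smul_mem (w 0) hA) (π.smul_mem (w 1) hB)) (π.smul_mem (w 2) hC)
    convert this using 1
    ext i j
    simp [hQ, hα, hβ, vw_apply]
    ring
  have hne : ∀ w : Fin 3 → ℂ, vw (b 0) (Q (α w)) + vw (b 1) (Q (β w))
      + (w 2 * (r1 - s0)) • vw (b 0) (b 1) = 0 → w = 0 := by
    intro w hw
    obtain ⟨h0, h1, h2⟩ := hli (w 0) (w 1) (w 2) (by
      rw [← hw]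
      ext i j
      simp [hQ, hα, hβ, vw_apply]
      ring)
    ext i
    fin_cases i <;> assumption
  obtain ⟨w0, w1, w2, h1, h2, hLI⟩ := exists_kronecker_chain (α := α) (β := β) (by
    intro w l m hlm hlm0
    by_contra hw
    have hr := hπ.rank_eq _ (hmem w) fun h => hw (hne w h)
    have hQlm : ∀ k, l * Q (α w) k + m * Q (β w) k = 0 := by
      intro k
      have e := fun i => congrFun hlm i
      have e0 := e 0
      have e1 := e 1
      have e2 := e 2
      have e3 := e 3
      simp only [Pi.add_apply, Pi.smul_apply, Pi.zero_apply, smul_eq_mul] at e0 e1 e2 e3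
      simp only [hQ, Pi.add_apply, Pi.smul_apply, smul_eq_mul]
      linear_combination b 2 k * e0 + b 3 k * e1 + b 4 k * e2 + b 5 k * e3
    by_cases hl : l = 0
    · have hm : m ≠ 0 := fun hm => hlm0 ⟨hl, hm⟩
      have hz : ∀ k, Q (β w) k = 0 := by
        intro k
        have := hQlm k
        simpa [hl, hm] using this
      have e : vw (b 0) (Q (α w)) + vw (b 1) (Q (β w)) + (w 2 * (r1 - s0)) • vw (b 0) (b 1)
          = vw (b 0) (Q (α w) + (w 2 * (r1 - s0)) • b 1) := by
        ext i j
        simp [vw_apply, hz]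
        ring
      rw [e] at hr
      have := rank_vw_le (b 0) (Q (α w) + (w 2 * (r1 - s0)) • b 1)
      omega
    · have hz : ∀ k, Q (α w) k = -(m / l) * Q (β w) k := by
        intro k
        have := hQlm k
        field_simp
        linear_combination this
      have e : vw (b 0) (Q (α w)) + vw (b 1) (Q (β w)) + (w 2 * (r1 - s0)) • vw (b 0) (b 1)
          = vw (b 1 - (m / l) • b 0) (Q (β w) - (w 2 * (r1 - s0)) • b 0) := by
        ext i j
        simp [vw_apply, hz]
        ring
      rw [e] at hr
      have := rank_vw_le (b 1 - (m / l) • b 0) (Q (β w) - (w 2 * (r1 - s0)) • b 0)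
      omega)
  have m0 := hmem w0
  have m1 := hmem w1
  have m2 := hmem w2
  rw [h1] at m0
  rw [h2] at m1
  rw [Fintype.linearIndependent_iff] at hLI
  generalize α w0 = q0 at *
  generalize α w1 = q1 at *
  generalize α w2 = q2 at *
  generalize β w2 = q3 at *
  generalize w0 2 * (r1 - s0) = g0 at *
  generalize w1 2 * (r1 - s0) = g1 at *
  generalize w2 2 * (r1 - s0) = g2 at *
  -- The multiples of `b 1` absorb the leftover `b0∧b1` terms of the three members.
  refine pglEquivalent_planeT (b := ![b 0, b 1, Q q0 + g0 • b 1, Q q1 + g1 • b 1, Q q2 + g2 • b 1,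
    Q q3]) hπ ?_ ?_ ?_ ?_
  · rw [Fintype.linearIndependent_iff]
    intro c hc
    have hz := Fintype.linearIndependent_iff.1 hb
      ![c 0, c 1 + c 2 * g0 + c 3 * g1 + c 4 * g2,
        c 2 * q0 0 + c 3 * q1 0 + c 4 * q2 0 + c 5 * q3 0,
        c 2 * q0 1 + c 3 * q1 1 + c 4 * q2 1 + c 5 * q3 1,
        c 2 * q0 2 + c 3 * q1 2 + c 4 * q2 2 + c 5 * q3 2,
        c 2 * q0 3 + c 3 * q1 3 + c 4 * q2 3 + c 5 * q3 3] (by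
        rw [← hc]
        simp [Fin.sum_univ_six, hQ]
        module)
    have z0 := hz 0
    have z1 := hz 1
    have z2 := hz 2
    have z3 := hz 3
    have z4 := hz 4
    have z5 := hz 5
    simp at z0 z1 z2 z3 z4 z5
    have hq := hLI ![c 2, c 3, c 4, c 5] (by
      ext i
      fin_cases i <;> simp [Fin.sum_univ_four]
      exacts [z2, z3, z4, z5])
    have y2 := hq 0
    have y3 := hq 1
    have y4 := hq 2
    have y5 := hq 3
    simp at y2 y3 y4 y5
    have y1 : c 1 = 0 := by simpa [y2, y3, y4] using z1
    intro i
    fin_cases i <;> assumption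
  · convert m0 using 1
    ext i j
    simp [vw_apply]
    ring
  · convert m1 using 1
    ext i j
    simp [vw_apply]
    ring
  · convert m2 using 1
    ext i j
    simp [vw_apply]
    ring

/-- A change of frame preserving the shape of a pencil of generic type. -/
theorem linearIndependent_twist (hb : LinearIndependent ℂ b) {p q r s : ℂ}
    (hD : p * s - q * r ≠ 0) :
    LinearIndependent ℂ ![(s / (p * s - q * r)) • b 0 - (r / (p * s - q * r)) • b 1,
      (p / (p * s - q * r)) • b 1 - (q / (p * s - q * r)) • b 0, p • b 2 + q • b 3,
      r • b 2 + s • b 3, p • b 4 + q • b 5, r • b 4 + s • b 5] := by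
  obtain ⟨D, hDe⟩ : ∃ D, D = p * s - q * r := ⟨_, rfl⟩
  rw [← hDe] at hD ⊢
  refine linearIndependent_of_expr hb !![p, r, 0, 0, 0, 0; q, s, 0, 0, 0, 0;
    0, 0, s / D, -q / D, 0, 0; 0, 0, -r / D, p / D, 0, 0; 0, 0, 0, 0, s / D, -q / D;
    0, 0, 0, 0, -r / D, p / D] ?_
  intro i
  fin_cases i <;> simp [Fin.sum_univ_six]
  all_goals
    ext k
    simp
    field_simp
    rw [hDe]
    ring

theorem exists_pglEquivalent_of_generic_pencil (hπ : IsConstantRankFourPlane π)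
    (hb : LinearIndependent ℂ b)
    (hA : vw (b 0) (b 2) + vw (b 1) (b 3) ∈ π) (hB : vw (b 0) (b 4) + vw (b 1) (b 5) ∈ π)
    {C : Mat6} (hC : C ∈ π)
    (hli : ∀ s t u : ℂ, s • (vw (b 0) (b 2) + vw (b 1) (b 3)) + t • (vw (b 0) (b 4) + vw (b 1) (b 5))
      + u • C = 0 → s = 0 ∧ t = 0 ∧ u = 0) :
    ∃ i, PGLEquivalent π (standardPlane i) := by
  obtain ⟨c01, c02, c03, c04, c05, c12, c13, c14, c15, c23, c24, c25, c34, c35, c45, rfl⟩ :=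
    exists_comb hb (hπ.skew C hC)
  have hpf : ∀ s t : ℂ, pf6 c01 (c02 + s) c03 (c04 + t) c05 c12 (c13 + s) c14 (c15 + t) c23 c24
      c25 c34 c35 c45 = 0 := by
    intro s t
    refine pf6_eq_zero hπ hb ?_
    have := π.add_mem (π.add_mem (π.smul_mem s hA) (π.smul_mem t hB)) hC
    convert this using 1
    simp only [comb]
    module
  have h00 := hpf 0 0
  have h10 := hpf 1 0
  have h20 := hpf (-1) 0
  have h01 := hpf 0 1
  have h02 := hpf 0 (-1)
  have h11 := hpf 1 1
  simp only [pf6] at h00 h10 h20 h01 h02 h11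
  -- Finite differences extract the coefficients of `s²`, `t²` and `st` in the Pfaffian.
  have e45 : c45 = 0 := by linear_combination -(h10 + h20 - 2 * h00) / 2
  have e23 : c23 = 0 := by linear_combination -(h01 + h02 - 2 * h00) / 2
  have e34 : c34 = c25 := by linear_combination -(h11 - h10 - h01 + h00)
  subst e45 e23 e34
  clear hpf h00 h10 h20 h01 h02 h11
  obtain ⟨ρ, hρ⟩ : ∃ ρ, ρ = c01 • b 1 + c02 • b 2 + c03 • b 3 + c04 • b 4 + c05 • b 5 := ⟨_, rfl⟩
  obtain ⟨σ, hσ⟩ : ∃ σ, σ = c12 • b 2 + c13 • b 3 + c14 • b 4 + c15 • b 5 := ⟨_, rfl⟩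
  have hCe : comb b c01 c02 c03 c04 c05 c12 c13 c14 c15 0 c24 c34 c34 c35 0 =
      c24 • vw (b 2) (b 4) + c34 • (vw (b 2) (b 5) + vw (b 3) (b 4)) + c35 • vw (b 3) (b 5)
        + vw (b 0) ρ + vw (b 1) σ := by
    rw [hρ, hσ]
    ext i j
    simp [comb, vw_apply]
    ring
  rw [hCe] at hC hli
  by_cases h0 : c24 = 0 ∧ 2 * c34 = 0 ∧ c35 = 0
  · obtain ⟨rfl, h34, rfl⟩ := h0
    obtain rfl : c34 = 0 := by simpa using h34
    simp only [zero_smul, zero_add] at hC hli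
    exact ⟨.t, pglEquivalent_planeT_of_pencil hπ hb hA hB hC hli⟩
  by_cases hD : c24 * c35 - c34 * c34 = 0
  · obtain ⟨p, q, hp, hpq, hq⟩ : ∃ p q : ℂ, c24 = p * p ∧ c34 = p * q ∧ c35 = q * q := by
      obtain ⟨p, hp⟩ := IsAlgClosed.exists_pow_nat_eq c24 (n := 2) (by norm_num)
      obtain ⟨q, hq⟩ := IsAlgClosed.exists_pow_nat_eq c35 (n := 2) (by norm_num)
      have : (c34 - p * q) * (c34 + p * q) = 0 := by
        rw [← hp, ← hq] at hD
        linear_combination -hD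
      rcases mul_eq_zero.1 this with h | h
      · exact ⟨p, q, by rw [← hp, sq], by linear_combination h, by rw [← hq, sq]⟩
      · exact ⟨p, -q, by rw [← hp, sq], by linear_combination h, by rw [← hq]; ring⟩
    obtain ⟨r, s, hrs⟩ : ∃ r s : ℂ, p * s - q * r = 1 := by
      by_cases hp0 : p = 0
      · have hq0 : q ≠ 0 := by
          rintro rfl
          exact h0 ⟨by simp [hp, hp0], by simp [hpq], by simp [hq]⟩
        exact ⟨-q⁻¹, 0, by field_simp; ring⟩
      · exact ⟨0, p⁻¹, by field_simp; ring⟩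
    refine ⟨.p, pglEquivalent_planeP_of_pencil hπ (linearIndependent_twist hb (p := p) (q := q)
      (r := r) (s := s) (by rw [hrs]; exact one_ne_zero)) (ρ := p • ρ + q • σ)
      (σ := r • ρ + s • σ) ?_ ?_ ?_⟩
    · convert hA using 1
      ext i j
      simp [vw_apply, hrs]
      linear_combination (b 0 i * b 2 j - b 2 i * b 0 j + b 1 i * b 3 j - b 3 i * b 1 j) * hrs
    · convert hB using 1
      ext i j
      simp [vw_apply, hrs]
      linear_combination (b 0 i * b 4 j - b 4 i * b 0 j + b 1 i * b 5 j - b 5 i * b 1 j) * hrs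
    · convert hC using 1
      ext i j
      simp [vw_apply, hrs, hp, hpq, hq]
      linear_combination (b 0 i * ρ j - ρ i * b 0 j + b 1 i * σ j - σ i * b 1 j) * hrs
  -- The form is `(p x + q y)(r x + s y)` with independent factors. Twisting by them gives `b2∧b5 +
  -- b3∧b4` for twice the form, whence the scaling of `C` by 2.
  · obtain ⟨p, q, r, s, -, -, hpr, hm, hqs⟩ := exists_quadratic_factor h0
    have hD' : p * s - q * r ≠ 0 := by
      intro h
      apply hD
      rw [hpr, hqs]
      linear_combination (-(2 * c34 + p * s + q * r) * hm - (p * s - q * r) * h) / 4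
    have hDi : (p * s - q * r) * (p * s - q * r)⁻¹ = 1 := mul_inv_cancel₀ hD'
    have h34 : c34 = (p * s + q * r) / 2 := by linear_combination hm / 2
    refine ⟨.g, pglEquivalent_planeG_of_pencil hπ (linearIndependent_twist hb hD')
      (ρ := (2 * p) • ρ + (2 * q) • σ) (σ := (2 * r) • ρ + (2 * s) • σ) ?_ ?_ ?_⟩
    · convert hA using 1
      ext i j
      simp [vw_apply, div_eq_mul_inv]
      linear_combination (b 0 i * b 2 j - b 2 i * b 0 j + b 1 i * b 3 j - b 3 i * b 1 j) * hDi
    · convert hB using 1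
      ext i j
      simp [vw_apply, div_eq_mul_inv]
      linear_combination (b 0 i * b 4 j - b 4 i * b 0 j + b 1 i * b 5 j - b 5 i * b 1 j) * hDi
    · convert π.smul_mem 2 hC using 1
      rw [hpr, hqs, h34]
      ext i j
      simp [vw_apply, div_eq_mul_inv]
      linear_combination 2 * (b 0 i * ρ j - ρ i * b 0 j + b 1 i * σ j - σ i * b 1 j) * hDi

end GenericPencil

/-! ### Special pencils with a common kernel vector -/

theorem vw_ne_zero {x y φ ψ : Fin 6 → ℂ}
    (h : (φ ⬝ᵥ x) * (ψ ⬝ᵥ y) - (φ ⬝ᵥ y) * (ψ ⬝ᵥ x) ≠ 0) : vw x y ≠ 0 := by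
  intro h0
  apply h
  have : φ ⬝ᵥ (vw x y *ᵥ ψ) = 0 := by rw [h0]; simp
  rw [vw_mulVec, dotProduct_sub, dotProduct_smul, dotProduct_smul, dotProduct_comm y,
    dotProduct_comm x] at this
  simp only [smul_eq_mul] at this
  linear_combination this

theorem vw_notMem {π : Submodule ℂ Mat6} (hπ : IsConstantRankFourPlane π) {x y : Fin 6 → ℂ}
    (h : vw x y ≠ 0) : vw x y ∉ π := by
  intro hm
  have := hπ.rank_eq _ hm h
  have := rank_vw_le x y
  omega

section SpecialPencil

variable {π : Submodule ℂ Mat6} {b : Fin 6 → Fin 6 → ℂ}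

theorem dotProduct_of_common_kernel (hb : LinearIndependent ℂ b)
    (hA : vw (b 0) (b 2) + vw (b 1) (b 3) ∈ π) (hB : vw (b 0) (b 3) + vw (b 1) (b 4) ∈ π)
    {n : Fin 6 → ℂ} (hn0 : n ≠ 0) (hn : ∀ M ∈ π, M *ᵥ n = 0) :
    b 0 ⬝ᵥ n = 0 ∧ b 1 ⬝ᵥ n = 0 ∧ b 2 ⬝ᵥ n = 0 ∧ b 3 ⬝ᵥ n = 0 ∧ b 4 ⬝ᵥ n = 0 ∧
      b 5 ⬝ᵥ n ≠ 0 := by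
  have h1 := hn _ hA
  have h2 := hn _ hB
  have key := Fintype.linearIndependent_iff.1 hb
  simp only [add_mulVec, vw_mulVec] at h1 h2
  have k1 := key ![b 2 ⬝ᵥ n, b 3 ⬝ᵥ n, -(b 0 ⬝ᵥ n), -(b 1 ⬝ᵥ n), 0, 0] (by
    rw [← h1]
    simp [Fin.sum_univ_six]
    module)
  have k2 := key ![b 3 ⬝ᵥ n, b 4 ⬝ᵥ n, 0, -(b 0 ⬝ᵥ n), -(b 1 ⬝ᵥ n), 0] (by
    rw [← h2]
    simp [Fin.sum_univ_six]
    module)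
  have e2 := k1 0
  have e3 := k1 1
  have e0 := k1 2
  have e1 := k1 3
  have e4 := k2 1
  simp at e0 e1 e2 e3 e4
  refine ⟨e0, e1, e2, e3, e4, fun e5 => hn0 ?_⟩
  have hu := isUnit_of_linearIndependent hb
  have : of b *ᵥ n = 0 := by
    ext i
    change b i ⬝ᵥ n = 0
    fin_cases i <;> assumption
  exact (Matrix.mulVec_injective_of_isUnit hu) (this.trans (mulVec_zero _).symm)

/-- In a space with a common kernel, the last coordinates of the residual vectors vanish. -/
theorem coord_five_eq_zero (hb : LinearIndependent ℂ b)
    (hA : vw (b 0) (b 2) + vw (b 1) (b 3) ∈ π) (hB : vw (b 0) (b 3) + vw (b 1) (b 4) ∈ π)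
    {n : Fin 6 → ℂ} (hn0 : n ≠ 0) (hn : ∀ M ∈ π, M *ᵥ n = 0) {k23 k24 k34 : ℂ}
    {r0 r1 r2 r3 r4 r5 s0 s1 s2 s3 s4 s5 : ℂ}
    (hC : k23 • vw (b 2) (b 3) + k24 • vw (b 2) (b 4) + k34 • vw (b 3) (b 4)
      + vw (b 0) (r0 • b 0 + r1 • b 1 + r2 • b 2 + r3 • b 3 + r4 • b 4 + r5 • b 5)
      + vw (b 1) (s0 • b 0 + s1 • b 1 + s2 • b 2 + s3 • b 3 + s4 • b 4 + s5 • b 5) ∈ π) :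
    r5 = 0 ∧ s5 = 0 := by
  obtain ⟨e0, e1, e2, e3, e4, e5⟩ := dotProduct_of_common_kernel hb hA hB hn0 hn
  have h3 := hn _ hC
  simp only [add_mulVec, smul_mulVec, vw_mulVec] at h3
  simp only [add_dotProduct, smul_dotProduct, e0, e1, e2, e3, e4] at h3
  have k3 := Fintype.linearIndependent_iff.1 hb ![r5 * (b 5 ⬝ᵥ n), s5 * (b 5 ⬝ᵥ n), 0, 0, 0, 0] (by
    rw [← h3]
    simp [Fin.sum_univ_six])
  have z0 := k3 0
  have z1 := k3 1
  simp [e5] at z0 z1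
  exact ⟨z0, z1⟩

/-- Residue with two distinct roots. Corrected vectors give `A = b0∧x + b1∧y`, `B = b0∧y + b1∧z`,
and `C` becomes `x∧z + g b0∧b1` modulo `A, B`. Here `g ≠ 0`, and its square root `l` (up to sign of
`g`) rescales the frame to `π_5`. -/
theorem pglEquivalent_planeFive_of_secant (hπ : IsConstantRankFourPlane π)
    (hb : LinearIndependent ℂ b)
    (hA : vw (b 0) (b 2) + vw (b 1) (b 3) ∈ π) (hB : vw (b 0) (b 3) + vw (b 1) (b 4) ∈ π)
    {n : Fin 6 → ℂ} (hn0 : n ≠ 0) (hn : ∀ M ∈ π, M *ᵥ n = 0) {ρ σ : Fin 6 → ℂ}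
    (hC : vw (b 2) (b 4) + vw (b 0) ρ + vw (b 1) σ ∈ π) : PGLEquivalent π planeFive := by
  obtain ⟨r0, r1, r2, r3, r4, r5, rfl⟩ := exists_coords hb ρ
  obtain ⟨s0, s1, s2, s3, s4, s5, rfl⟩ := exists_coords hb σ
  obtain ⟨rfl, rfl⟩ := coord_five_eq_zero hb hA hB hn0 hn (k23 := 0) (k24 := 1) (k34 := 0)
    (by simpa using hC)
  obtain ⟨v, -, hv, -⟩ := exists_dual_frame hb
  obtain ⟨p, hp⟩ : ∃ p, p = s4 - r3 := ⟨_, rfl⟩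
  obtain ⟨q, hq⟩ : ∃ q, q = s3 - r2 := ⟨_, rfl⟩
  obtain ⟨x, hx⟩ : ∃ x, x = b 2 + r4 • b 0 + p • b 1 := ⟨_, rfl⟩
  obtain ⟨y, hy⟩ : ∃ y, y = b 3 + p • b 0 + q • b 1 := ⟨_, rfl⟩
  obtain ⟨z, hz⟩ : ∃ z, z = b 4 + q • b 0 - s2 • b 1 := ⟨_, rfl⟩
  obtain ⟨g, hg⟩ : ∃ g, g = r1 - s0 + r4 * s2 + p * q := ⟨_, rfl⟩
  have hC' : vw x z + g • vw (b 0) (b 1) ∈ π := by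
    convert π.sub_mem (π.sub_mem hC (π.smul_mem s3 hA)) (π.smul_mem r3 hB) using 1
    rw [hx, hz, hg, hp, hq]
    ext i j
    simp [vw_apply]
    ring
  obtain ⟨l, hl⟩ := IsAlgClosed.exists_pow_nat_eq (-g) (n := 2) (by norm_num)
  have hl0 : l ≠ 0 := by
    rintro rfl
    obtain rfl : g = 0 := by simpa using hl.symm
    refine vw_notMem hπ (vw_ne_zero (φ := v 2) (ψ := v 4) ?_) (x := x) (y := z)
      (by simpa using hC')
    simp [hx, hz, hv]
  refine pglEquivalent_planeFive (b := ![-x, l • b 1, y, l • b 0, -z, b 5]) hπ ?_ ?_ ?_ ?_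
  · refine linearIndependent_of_expr hb !![0, 0, 0, l⁻¹, 0, 0; 0, l⁻¹, 0, 0, 0, 0;
      -1, -p / l, 0, -r4 / l, 0, 0; 0, -q / l, 1, -p / l, 0, 0; 0, s2 / l, 0, -q / l, -1, 0;
      0, 0, 0, 0, 0, 1] ?_
    intro i
    fin_cases i <;> simp [Fin.sum_univ_six, smul_smul, hl0, hx, hy, hz]
    all_goals
      ext k
      simp
      field_simp
      ring
  · convert π.smul_mem l hA using 1
    ext i j
    simp [vw_apply, hx, hy]
    ring
  · convert hC' using 1
    ext i j
    simp [vw_apply]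
    linear_combination (b 1 i * b 0 j - b 0 i * b 1 j) * hl
  · convert π.smul_mem (-l) hB using 1
    ext i j
    simp [vw_apply, hy, hz]
    ring

/-- Residue with a double root. Modulo `A, B`, `C` becomes `x∧y + r4 b0∧b4 + g b0∧b1`; if `r4 = 0`,
then with `l² = g` subtracting `l A` leaves the decomposable `(x - l b1)∧(y + l b0)`, so `r4 ≠ 0`
and `b 4` can absorb `g`. -/
theorem pglEquivalent_planeFive_of_tangent (hπ : IsConstantRankFourPlane π)
    (hb : LinearIndependent ℂ b)
    (hA : vw (b 0) (b 2) + vw (b 1) (b 3) ∈ π) (hB : vw (b 0) (b 3) + vw (b 1) (b 4) ∈ π)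
    {n : Fin 6 → ℂ} (hn0 : n ≠ 0) (hn : ∀ M ∈ π, M *ᵥ n = 0) {ρ σ : Fin 6 → ℂ}
    (hC : vw (b 2) (b 3) + vw (b 0) ρ + vw (b 1) σ ∈ π) : PGLEquivalent π planeFive := by
  obtain ⟨r0, r1, r2, r3, r4, r5, rfl⟩ := exists_coords hb ρ
  obtain ⟨s0, s1, s2, s3, s4, s5, rfl⟩ := exists_coords hb σ
  obtain ⟨rfl, rfl⟩ := coord_five_eq_zero hb hA hB hn0 hn (k23 := 1) (k24 := 0) (k34 := 0)
    (by simpa using hC)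
  obtain ⟨v, -, hv, -⟩ := exists_dual_frame hb
  obtain ⟨p, hp⟩ : ∃ p, p = (s3 - r2) / 2 := ⟨_, rfl⟩
  obtain ⟨q, hq⟩ : ∃ q, q = r3 - s4 := ⟨_, rfl⟩
  obtain ⟨g, hg⟩ : ∃ g, g = r1 - s0 + q * s2 + p * p := ⟨_, rfl⟩
  obtain ⟨x, hx⟩ : ∃ x, x = b 2 + q • b 0 + p • b 1 := ⟨_, rfl⟩
  obtain ⟨y, hy⟩ : ∃ y, y = b 3 + p • b 0 - s2 • b 1 := ⟨_, rfl⟩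
  have hC' : vw x y + r4 • vw (b 0) (b 4) + g • vw (b 0) (b 1) ∈ π := by
    convert π.sub_mem (π.sub_mem hC (π.smul_mem ((r2 + s3) / 2) hA)) (π.smul_mem s4 hB) using 1
    rw [hx, hy, hg, hp, hq]
    ext i j
    simp [vw_apply]
    ring
  by_cases h4 : r4 = 0
  · exfalso
    obtain ⟨l, hl⟩ := IsAlgClosed.exists_pow_nat_eq g (n := 2) (by norm_num)
    refine vw_notMem hπ (vw_ne_zero (φ := v 2) (ψ := v 3) ?_) (x := x - l • b 1)
      (y := y + l • b 0) ?_
    · simp [hx, hy, hv]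
    · convert π.add_mem (π.smul_mem (-l) hA) hC' using 1
      rw [h4, hx, hy]
      ext i j
      simp [vw_apply]
      linear_combination (b 0 i * b 1 j - b 1 i * b 0 j) * hl
  · obtain ⟨z, hz⟩ : ∃ z, z = b 4 - s2 • b 0 + (g / r4) • b 1 := ⟨_, rfl⟩
    refine pglEquivalent_planeFive (b := ![r4 • b 1, r4 • b 0, x, y, z, b 5]) hπ ?_ ?_ ?_ ?_
    · refine linearIndependent_of_expr hb !![0, r4⁻¹, 0, 0, 0, 0; r4⁻¹, 0, 0, 0, 0, 0;
        -p / r4, -q / r4, 1, 0, 0, 0; s2 / r4, -p / r4, 0, 1, 0, 0;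
        -(g / r4) / r4, s2 / r4, 0, 0, 1, 0; 0, 0, 0, 0, 0, 1] ?_
      intro i
      fin_cases i <;> simp [Fin.sum_univ_six, smul_smul, h4, hx, hy, hz]
      all_goals
        ext k
        simp
        field_simp
        ring
    · convert π.smul_mem r4 hA using 1
      ext i j
      simp [vw_apply, hx, hy]
      ring
    · convert π.smul_mem r4 hB using 1
      ext i j
      simp [vw_apply, hy, hz]
      field_simp
      ring
    · convert hC' using 1
      ext i j
      simp [vw_apply, hz]
      field_simp
      ring

theorem pglEquivalent_planeFive_of_left (hπ : IsConstantRankFourPlane π)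
    (hb : LinearIndependent ℂ b)
    (hA : vw (b 0) (b 2) + vw (b 1) (b 3) ∈ π) (hB : vw (b 0) (b 3) + vw (b 1) (b 4) ∈ π)
    {n : Fin 6 → ℂ} (hn0 : n ≠ 0) (hn : ∀ M ∈ π, M *ᵥ n = 0) {ρ σ : Fin 6 → ℂ} {k l : ℂ}
    (hkl : ¬(k = 0 ∧ l = 0))
    (hC : k • vw (b 2) (b 3) + l • vw (b 2) (b 4) + vw (b 0) ρ + vw (b 1) σ ∈ π) :
    PGLEquivalent π planeFive := by
  by_cases hl : l = 0
  · have hk : k ≠ 0 := fun hk => hkl ⟨hk, hl⟩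
    refine pglEquivalent_planeFive_of_tangent hπ hb hA hB hn0 hn (ρ := k⁻¹ • ρ) (σ := k⁻¹ • σ) ?_
    convert π.smul_mem k⁻¹ hC using 1
    rw [hl]
    ext i j
    simp [vw_apply]
    field_simp
  -- A unipotent change of frame, acting on `b2, b3, b4` as on a symmetric square, preserves the
  -- pencil and completes the square to remove `b2∧b3`.
  · obtain ⟨r, hr⟩ : ∃ r, k + 2 * l * r = 0 := ⟨-k / (2 * l), by field_simp; ring⟩
    refine pglEquivalent_planeFive_of_secant (b := ![b 0 + r • b 1, b 1, b 2, b 3 - r • b 2,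
      b 4 - (2 * r) • b 3 + (r * r) • b 2, b 5]) hπ ?_ ?_ ?_ hn0 hn (ρ := l⁻¹ • ρ)
      (σ := l⁻¹ • (σ - r • ρ)) ?_
    · refine linearIndependent_of_expr hb !![1, -r, 0, 0, 0, 0; 0, 1, 0, 0, 0, 0;
        0, 0, 1, 0, 0, 0; 0, 0, r, 1, 0, 0; 0, 0, r * r, 2 * r, 1, 0; 0, 0, 0, 0, 0, 1] ?_
      intro i
      fin_cases i <;> simp [Fin.sum_univ_six]
      all_goals
        ext k
        simp
        try ring
    · convert hA using 1
      ext i j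
      simp [vw_apply]
      ring
    · convert π.sub_mem hB (π.smul_mem r hA) using 1
      ext i j
      simp [vw_apply]
      ring
    · convert π.smul_mem l⁻¹ hC using 1
      obtain rfl : k = -(2 * l * r) := by linear_combination hr
      ext i j
      simp [vw_apply]
      field_simp
      ring

theorem pglEquivalent_planeFive_of_ne_zero (hπ : IsConstantRankFourPlane π)
    (hb : LinearIndependent ℂ b)
    (hA : vw (b 0) (b 2) + vw (b 1) (b 3) ∈ π) (hB : vw (b 0) (b 3) + vw (b 1) (b 4) ∈ π)
    {n : Fin 6 → ℂ} (hn0 : n ≠ 0) (hn : ∀ M ∈ π, M *ᵥ n = 0) {ρ σ : Fin 6 → ℂ} {k l m : ℂ}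
    (hkl : ¬(k = 0 ∧ l = 0 ∧ m = 0))
    (hC : k • vw (b 2) (b 3) + l • vw (b 2) (b 4) + m • vw (b 3) (b 4) + vw (b 0) ρ + vw (b 1) σ
      ∈ π) : PGLEquivalent π planeFive := by
  by_cases h0 : k = 0 ∧ l = 0
  · obtain ⟨rfl, rfl⟩ := h0
    refine pglEquivalent_planeFive_of_left (b := ![b 1, b 0, b 4, b 3, b 2, b 5]) hπ ?_ ?_ ?_ hn0 hn
      (ρ := σ) (σ := ρ) (k := -m) (l := 0) (by simpa using hkl) ?_
    · refine linearIndependent_of_expr hb !![0, 1, 0, 0, 0, 0; 1, 0, 0, 0, 0, 0;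
        0, 0, 0, 0, 1, 0; 0, 0, 0, 1, 0, 0; 0, 0, 1, 0, 0, 0; 0, 0, 0, 0, 0, 1] ?_
      intro i
      fin_cases i <;> simp [Fin.sum_univ_six]
    · convert hB using 1
      ext i j
      simp [vw_apply]
      ring
    · convert hA using 1
      ext i j
      simp [vw_apply]
      ring
    · convert hC using 1
      ext i j
      simp [vw_apply]
      ring
  -- A root of the residual quadratic form; moving it by a unipotent change of frame kills the
  -- `b3∧b4` coefficient.
  · obtain ⟨r, hr⟩ : ∃ r, k * (r * r) + 2 * l * r + m = 0 := by
      by_cases hk : k = 0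
      · have hl : l ≠ 0 := fun hl => h0 ⟨hk, hl⟩
        exact ⟨-m / (2 * l), by rw [hk]; field_simp; ring⟩
      · obtain ⟨r, hr⟩ := exists_sq_add_mul_add_eq_zero (2 * l / k) (m / k)
        refine ⟨r, ?_⟩
        field_simp at hr
        linear_combination hr
    refine pglEquivalent_planeFive_of_left (b := ![b 0, b 1 + r • b 0,
      b 2 - (2 * r) • b 3 + (r * r) • b 4, b 3 - r • b 4, b 4, b 5]) hπ ?_ ?_ ?_ hn0 hn
      (ρ := ρ - r • σ) (σ := σ) (k := k) (l := k * r + l) ?_ ?_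
    · refine linearIndependent_of_expr hb !![1, 0, 0, 0, 0, 0; -r, 1, 0, 0, 0, 0;
        0, 0, 1, 2 * r, r * r, 0; 0, 0, 0, 1, r, 0; 0, 0, 0, 0, 1, 0; 0, 0, 0, 0, 0, 1] ?_
      intro i
      fin_cases i <;> simp [Fin.sum_univ_six]
      all_goals
        ext k
        simp
        try ring
    · convert π.sub_mem hA (π.smul_mem r hB) using 1
      ext i j
      simp [vw_apply]
      ring
    · convert hB using 1
      ext i j
      simp [vw_apply]
      ring
    · rintro ⟨rfl, h⟩
      exact h0 ⟨rfl, by simpa using h⟩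
    · convert hC using 1
      ext i j
      simp [vw_apply]
      linear_combination -(b 3 i * b 4 j - b 4 i * b 3 j) * hr

/-- With no residue, some member is decomposable. In `sA + tB + C`, the coordinates wedged with `b
0` and `b 1` are `(s + r2, t + r3, r4)` and `(s2, s + s3, t + s4)`; requiring the second to be `l`
times the first determines `t`, then `s`, and leaves a cubic for `l`. When `r4 = 0` the root is at
infinity and the common factor is `b 1`. -/
theorem notMem_of_residue_eq_zero (hπ : IsConstantRankFourPlane π) (hb : LinearIndependent ℂ b)
    (hA : vw (b 0) (b 2) + vw (b 1) (b 3) ∈ π) (hB : vw (b 0) (b 3) + vw (b 1) (b 4) ∈ π)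
    {n : Fin 6 → ℂ} (hn0 : n ≠ 0) (hn : ∀ M ∈ π, M *ᵥ n = 0) {ρ σ : Fin 6 → ℂ}
    (hli : ∀ s t : ℂ, s • (vw (b 0) (b 2) + vw (b 1) (b 3)) + t • (vw (b 0) (b 3) + vw (b 1) (b 4))
      + (vw (b 0) ρ + vw (b 1) σ) ≠ 0) :
    vw (b 0) ρ + vw (b 1) σ ∉ π := by
  intro hC
  obtain ⟨r0, r1, r2, r3, r4, r5, rfl⟩ := exists_coords hb ρ
  obtain ⟨s0, s1, s2, s3, s4, s5, rfl⟩ := exists_coords hb σ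
  obtain ⟨rfl, rfl⟩ := coord_five_eq_zero hb hA hB hn0 hn (k23 := 0) (k24 := 0) (k34 := 0)
    (by simpa using hC)
  have hmem := fun s t : ℂ => π.add_mem (π.add_mem (π.smul_mem s hA) (π.smul_mem t hB)) hC
  by_cases h4 : r4 = 0
  · have e : (-r2) • (vw (b 0) (b 2) + vw (b 1) (b 3)) + (-r3) • (vw (b 0) (b 3) + vw (b 1) (b 4))
        + (vw (b 0) (r0 • b 0 + r1 • b 1 + r2 • b 2 + r3 • b 3 + r4 • b 4 + (0 : ℂ) • b 5)
          + vw (b 1) (s0 • b 0 + s1 • b 1 + s2 • b 2 + s3 • b 3 + s4 • b 4 + (0 : ℂ) • b 5))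
        = vw (b 1) ((s0 - r1) • b 0 + s2 • b 2 + (s3 - r2) • b 3 + (s4 - r3) • b 4) := by
      rw [h4]
      ext i j
      simp [vw_apply]
      ring
    have h1 := hmem (-r2) (-r3)
    have h2 := hli (-r2) (-r3)
    rw [e] at h1 h2
    exact vw_notMem hπ h2 h1
  · obtain ⟨l, hl⟩ := exists_cubic_root ((r3 - s4) / r4) ((r2 - s3) / r4) (-s2 / r4)
    field_simp at hl
    obtain ⟨t, ht⟩ : ∃ t, t = l * r4 - s4 := ⟨_, rfl⟩
    obtain ⟨s, hs⟩ : ∃ s, s = l * (t + r3) - s3 := ⟨_, rfl⟩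
    have hs2 : s2 = l * (s + r2) := by
      rw [hs, ht]
      linear_combination -hl
    have e : s • (vw (b 0) (b 2) + vw (b 1) (b 3)) + t • (vw (b 0) (b 3) + vw (b 1) (b 4))
        + (vw (b 0) (r0 • b 0 + r1 • b 1 + r2 • b 2 + r3 • b 3 + r4 • b 4 + (0 : ℂ) • b 5)
          + vw (b 1) (s0 • b 0 + s1 • b 1 + s2 • b 2 + s3 • b 3 + s4 • b 4 + (0 : ℂ) • b 5))
        = vw (b 0 + l • b 1) ((r1 - s0) • b 1 + (s + r2) • b 2 + (t + r3) • b 3 + r4 • b 4) := by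
      rw [hs2]
      ext i j
      simp [vw_apply]
      rw [hs, ht]
      ring
    have h1 := hmem s t
    have h2 := hli s t
    rw [e] at h1 h2
    exact vw_notMem hπ h2 h1

end SpecialPencil

/-! ### From pencils to planes: existence of a normal form -/

theorem exists_pair {π : Submodule ℂ Mat6} (hπ : IsConstantRankFourPlane π) :
    ∃ A ∈ π, ∃ B ∈ π, LinearIndependent ℂ ![A, B] := by
  have hpos : 0 < Module.finrank ℂ π := by rw [hπ.finrank_eq]; norm_num
  obtain ⟨A, hA0⟩ := Module.finrank_pos_iff_exists_ne_zero.1 hpos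
  obtain ⟨B, hB⟩ := exists_linearIndependent_pair_of_one_lt_finrank
    (by rw [hπ.finrank_eq]; norm_num) hA0
  refine ⟨A, A.2, B, B.2, ?_⟩
  rw [LinearIndependent.pair_iff] at hB ⊢
  intro s t h
  exact hB s t (Subtype.ext h)

theorem exists_third {π : Submodule ℂ Mat6} (hπ : IsConstantRankFourPlane π) {A B : Mat6}
    (hA : A ∈ π) (hB : B ∈ π) (hAB : LinearIndependent ℂ ![A, B]) :
    ∃ C ∈ π, (∀ s t u : ℂ, s • A + t • B + u • C = 0 → s = 0 ∧ t = 0 ∧ u = 0) ∧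
      ∀ M ∈ π, ∃ s t u : ℂ, M = s • A + t • B + u • C := by
  have hli : LinearIndependent ℂ ![(⟨A, hA⟩ : π), ⟨B, hB⟩] := by
    rw [LinearIndependent.pair_iff] at hAB ⊢
    intro s t h
    exact hAB s t (congrArg Subtype.val h)
  obtain ⟨C, hC⟩ := exists_linearIndependent_cons_of_lt_finrank hli
    (by rw [hπ.finrank_eq]; norm_num)
  refine ⟨C, C.2, ?_, ?_⟩
  · intro s t u h
    have h3 := Fintype.linearIndependent_iff.1 hC ![u, s, t] (by
      rw [Fin.sum_univ_three]
      apply Subtype.ext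
      simp
      rw [← h]
      module)
    exact ⟨h3 1, h3 2, h3 0⟩
  · intro M hM
    have htop := hC.span_eq_top_of_card_eq_finrank (by rw [hπ.finrank_eq]; simp)
    have hMm : (⟨M, hM⟩ : π) ∈ Submodule.span ℂ
        (Set.range (Fin.cons C ![(⟨A, hA⟩ : π), ⟨B, hB⟩] : Fin 3 → π)) := by
      rw [htop]
      trivial
    obtain ⟨c, hc⟩ := (Submodule.mem_span_range_iff_exists_fun ℂ).1 hMm
    refine ⟨c 1, c 2, c 0, ?_⟩
    rw [Fin.sum_univ_three] at hc
    have := congrArg Subtype.val hc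
    simp at this
    rw [← this]
    abel

theorem not_three_kernel {M : Mat6} (h : M.rank = 4) {v : Fin 3 → Fin 6 → ℂ}
    (hv : LinearIndependent ℂ v) (hM : ∀ i, M *ᵥ v i = 0) : False := by
  have hle : Submodule.span ℂ (Set.range v) ≤ LinearMap.ker M.mulVecLin := by
    refine Submodule.span_le.2 ?_
    rintro _ ⟨i, rfl⟩
    exact hM i
  have h1 := Submodule.finrank_mono hle
  rw [finrank_span_eq_card hv] at h1
  have r1 := LinearMap.finrank_range_add_finrank_ker M.mulVecLin
  simp at r1 h1
  change M.rank + _ = 6 at r1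
  omega

theorem exists_smul_eq {C : Mat6} {x y : Fin 6 → ℂ} {k l : ℂ} (hy : C *ᵥ y ≠ 0)
    (hn : k • x + l • y ≠ 0) (h : C *ᵥ (k • x + l • y) = 0) : ∃ m : ℂ, C *ᵥ (x - m • y) = 0 := by
  have hk : k ≠ 0 := by
    rintro rfl
    rw [zero_smul, zero_add] at h hn
    rw [mulVec_smul, smul_eq_zero] at h
    rcases h with rfl | h
    · simp at hn
    · exact hy h
  refine ⟨-(l / k), ?_⟩
  have e : x - (-(l / k)) • y = k⁻¹ • (k • x + l • y) := by
    rw [smul_add, smul_smul, smul_smul, inv_mul_cancel₀ hk]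
    module
  rw [e, mulVec_smul, h, smul_zero]

/-- The vector `v 5` spans the common kernel of `A` and `B`. The kernels of `A`, `B` and `A + B` are
spanned by `v 5` together with `v 4`, `v 2` and `v 2 - v 3 + v 4`, and each meets `ker C`. If `C`
did not kill `v 5`, these would give three vectors of `ker C` independent modulo `v 5`, whereas that
kernel has dimension two. -/
theorem exists_common_kernel {π : Submodule ℂ Mat6} (hπ : IsConstantRankFourPlane π)
    (hpair : ∀ X ∈ π, ∀ Y ∈ π, LinearIndependent ℂ ![X, Y] →
      ∃ n : Fin 6 → ℂ, n ≠ 0 ∧ X *ᵥ n = 0 ∧ Y *ᵥ n = 0)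
    {b : Fin 6 → Fin 6 → ℂ} (hb : LinearIndependent ℂ b)
    (hA : vw (b 0) (b 2) + vw (b 1) (b 3) ∈ π) (hB : vw (b 0) (b 3) + vw (b 1) (b 4) ∈ π)
    {C : Mat6} (hC : C ∈ π)
    (hli : ∀ s t u : ℂ, s • (vw (b 0) (b 2) + vw (b 1) (b 3)) + t • (vw (b 0) (b 3) + vw (b 1) (b 4))
      + u • C = 0 → s = 0 ∧ t = 0 ∧ u = 0)
    (hspan : ∀ M ∈ π, ∃ s t u : ℂ, M = s • (vw (b 0) (b 2) + vw (b 1) (b 3))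
      + t • (vw (b 0) (b 3) + vw (b 1) (b 4)) + u • C) :
    ∃ n : Fin 6 → ℂ, n ≠ 0 ∧ ∀ M ∈ π, M *ᵥ n = 0 := by
  obtain ⟨v, hvl, hv, -⟩ := exists_dual_frame hb
  have hbv : ∀ i j, b i ⬝ᵥ v j = if i = j then 1 else 0 := by
    intro i j
    rw [dotProduct_comm, hv]
    simp [eq_comm]
  suffices h5 : C *ᵥ v 5 = 0 by
    refine ⟨v 5, hvl.ne_zero 5, fun M hM => ?_⟩
    obtain ⟨s, t, u, rfl⟩ := hspan M hM
    simp [add_mulVec, smul_mulVec, vw_mulVec, hbv, h5]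
  by_contra h5
  have hkey := Fintype.linearIndependent_iff.1 hb
  have hstep : ∀ s t : ℂ, ¬(s = 0 ∧ t = 0) → ∃ x0 x1 x2 x3 x4 x5 : ℂ,
      x0 • v 0 + x1 • v 1 + x2 • v 2 + x3 • v 3 + x4 • v 4 + x5 • v 5 ≠ 0 ∧
      C *ᵥ (x0 • v 0 + x1 • v 1 + x2 • v 2 + x3 • v 3 + x4 • v 4 + x5 • v 5) = 0 ∧
      s * x2 + t * x3 = 0 ∧ s * x3 + t * x4 = 0 ∧ s * x0 = 0 ∧ s * x1 + t * x0 = 0 ∧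
      t * x1 = 0 := by
    intro s t hst
    obtain ⟨n, hn0, hn, hCn⟩ := hpair _ (π.add_mem (π.smul_mem s hA) (π.smul_mem t hB)) C hC (by
      rw [LinearIndependent.pair_iff]
      intro k l h
      obtain ⟨h1, h2, h3⟩ := hli (k * s) (k * t) l (by rw [← h]; module)
      refine ⟨?_, h3⟩
      by_contra hk
      exact hst ⟨by simpa [hk] using h1, by simpa [hk] using h2⟩)
    obtain ⟨x0, x1, x2, x3, x4, x5, rfl⟩ := exists_coords hvl n
    refine ⟨x0, x1, x2, x3, x4, x5, hn0, hCn, ?_⟩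
    have k1 := hkey ![s * x2 + t * x3, s * x3 + t * x4, -(s * x0), -(s * x1 + t * x0), -(t * x1), 0]
      (by
        rw [← hn]
        simp [Fin.sum_univ_six, add_mulVec, smul_mulVec, vw_mulVec, hbv]
        module)
    have e0 := k1 0
    have e1 := k1 1
    have e2 := k1 2
    have e3 := k1 3
    have e4 := k1 4
    simp only [cons_val, neg_eq_zero] at e0 e1 e2 e3 e4
    exact ⟨e0, e1, e2, e3, e4⟩
  obtain ⟨m4, hm4⟩ : ∃ m : ℂ, C *ᵥ (v 4 - m • v 5) = 0 := by
    obtain ⟨x0, x1, x2, x3, x4, x5, hn, hCn, e0, e1, e2, e3, e4⟩ := hstep 1 0 (by simp)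
    simp at e0 e1 e2 e3
    simp only [e0, e1, e2, e3, zero_smul, zero_add] at hn hCn
    exact exists_smul_eq h5 hn hCn
  obtain ⟨m2, hm2⟩ : ∃ m : ℂ, C *ᵥ (v 2 - m • v 5) = 0 := by
    obtain ⟨x0, x1, x2, x3, x4, x5, hn, hCn, e0, e1, e2, e3, e4⟩ := hstep 0 1 (by simp)
    simp at e0 e1 e3 e4
    simp only [e0, e1, e3, e4, zero_smul, zero_add, add_zero] at hn hCn
    exact exists_smul_eq h5 hn hCn
  obtain ⟨m3, hm3⟩ : ∃ m : ℂ, C *ᵥ ((v 2 - v 3 + v 4) - m • v 5) = 0 := by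
    obtain ⟨x0, x1, x2, x3, x4, x5, hn, hCn, e0, e1, e2, e3, e4⟩ := hstep 1 1 (by simp)
    simp at e0 e1 e2 e4
    have e3' : x3 = -x4 := by linear_combination e1
    have e2' : x2 = x4 := by linear_combination e0 - e1
    have e : x0 • v 0 + x1 • v 1 + x2 • v 2 + x3 • v 3 + x4 • v 4 + x5 • v 5
        = x4 • (v 2 - v 3 + v 4) + x5 • v 5 := by
      rw [e2, e4, e3', e2']
      module
    rw [e] at hn hCn
    exact exists_smul_eq h5 hn hCn
  have hC0 : C ≠ 0 := by
    rintro rfl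
    have := hli 0 0 1 (by simp)
    simp at this
  refine not_three_kernel (hπ.rank_eq C hC hC0)
    (v := ![v 4 - m4 • v 5, v 2 - m2 • v 5, (v 2 - v 3 + v 4) - m3 • v 5]) ?_ ?_
  · rw [Fintype.linearIndependent_iff]
    intro c hc
    have hz := Fintype.linearIndependent_iff.1 hvl
      ![0, 0, c 1 + c 2, -c 2, c 0 + c 2, -(c 0 * m4 + c 1 * m2 + c 2 * m3)] (by
        rw [← hc]
        simp [Fin.sum_univ_six, Fin.sum_univ_three]
        module)
    have z2 := hz 2
    have z3 := hz 3
    have z4 := hz 4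
    simp at z2 z3 z4
    have y0 : c 0 = 0 := by simpa [z3] using z4
    have y1 : c 1 = 0 := by simpa [z3] using z2
    intro i
    fin_cases i <;> assumption
  · intro i
    fin_cases i
    exacts [hm4, hm2, hm3]

theorem exists_pglEquivalent {π : Submodule ℂ Mat6} (hπ : IsConstantRankFourPlane π) :
    ∃ i, PGLEquivalent π (standardPlane i) := by
  -- The dichotomy is whether some pencil of the plane is generic; if none is, every independent
  -- pair of members has a common kernel vector.
  by_cases hgen : ∃ b : Fin 6 → Fin 6 → ℂ, LinearIndependent ℂ b ∧
      vw (b 0) (b 2) + vw (b 1) (b 3) ∈ π ∧ vw (b 0) (b 4) + vw (b 1) (b 5) ∈ π ∧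
      LinearIndependent ℂ ![vw (b 0) (b 2) + vw (b 1) (b 3), vw (b 0) (b 4) + vw (b 1) (b 5)]
  · obtain ⟨b, hb, hA, hB, hAB⟩ := hgen
    obtain ⟨C, hC, hli, -⟩ := exists_third hπ hA hB hAB
    exact exists_pglEquivalent_of_generic_pencil hπ hb hA hB hC hli
  have htype : ∀ X ∈ π, ∀ Y ∈ π, LinearIndependent ℂ ![X, Y] →
      ∃ b : Fin 6 → Fin 6 → ℂ, LinearIndependent ℂ b ∧ X = vw (b 0) (b 2) + vw (b 1) (b 3) ∧
        ∃ c : ℂ, Y = c • X + (vw (b 0) (b 3) + vw (b 1) (b 4)) := by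
    intro X hX Y hY hXY
    refine (pencil_type hπ hX hY hXY).resolve_left ?_
    rintro ⟨b, hb, rfl, rfl⟩
    exact hgen ⟨b, hb, hX, hY, hXY⟩
  have hpair : ∀ X ∈ π, ∀ Y ∈ π, LinearIndependent ℂ ![X, Y] →
      ∃ n : Fin 6 → ℂ, n ≠ 0 ∧ X *ᵥ n = 0 ∧ Y *ᵥ n = 0 := by
    intro X hX Y hY hXY
    obtain ⟨b, hb, rfl, c, rfl⟩ := htype X hX Y hY hXY
    obtain ⟨v, hvl, hv, -⟩ := exists_dual_frame hb
    have hbv : ∀ i, i ≠ 5 → b i ⬝ᵥ v 5 = 0 := by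
      intro i hi
      rw [dotProduct_comm, hv, if_neg hi.symm]
    refine ⟨v 5, hvl.ne_zero 5, ?_, ?_⟩ <;> simp [add_mulVec, smul_mulVec, vw_mulVec, hbv]
  obtain ⟨A, hA, Y, hY, hAY⟩ := exists_pair hπ
  obtain ⟨b, hb, rfl, c, rfl⟩ := htype A hA Y hY hAY
  have hB : vw (b 0) (b 3) + vw (b 1) (b 4) ∈ π := by
    have := π.sub_mem hY (π.smul_mem c hA)
    rwa [add_sub_cancel_left] at this
  have hAB : LinearIndependent ℂ
      ![vw (b 0) (b 2) + vw (b 1) (b 3), vw (b 0) (b 3) + vw (b 1) (b 4)] := by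
    rw [LinearIndependent.pair_iff] at hAY ⊢
    intro s t h
    obtain ⟨h1, rfl⟩ := hAY (s - t * c) t (by rw [← h]; module)
    exact ⟨by simpa using h1, rfl⟩
  obtain ⟨C, hC, hli, hspan⟩ := exists_third hπ hA hB hAB
  obtain ⟨n, hn0, hn⟩ := exists_common_kernel hπ hpair hb hA hB hC hli hspan
  obtain ⟨e0, e1, e2, e3, e4, e5⟩ := dotProduct_of_common_kernel hb hA hB hn0 hn
  obtain ⟨c01, c02, c03, c04, c05, c12, c13, c14, c15, c23, c24, c25, c34, c35, c45, rfl⟩ :=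
    exists_comb hb (hπ.skew C hC)
  have hCn := hn _ hC
  simp only [comb, add_mulVec, smul_mulVec, vw_mulVec, e0, e1, e2, e3, e4] at hCn
  have hz := Fintype.linearIndependent_iff.1 hb ![c05 * (b 5 ⬝ᵥ n), c15 * (b 5 ⬝ᵥ n),
    c25 * (b 5 ⬝ᵥ n), c35 * (b 5 ⬝ᵥ n), c45 * (b 5 ⬝ᵥ n), 0] (by
      rw [← hCn]
      simp [Fin.sum_univ_six, smul_smul])
  have z2 := hz 2
  have z3 := hz 3
  have z4 := hz 4
  simp [e5] at z2 z3 z4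
  obtain ⟨ρ, hρ⟩ : ∃ ρ, ρ = c01 • b 1 + c02 • b 2 + c03 • b 3 + c04 • b 4 + c05 • b 5 := ⟨_, rfl⟩
  obtain ⟨σ, hσ⟩ : ∃ σ, σ = c12 • b 2 + c13 • b 3 + c14 • b 4 + c15 • b 5 := ⟨_, rfl⟩
  have hCe : comb b c01 c02 c03 c04 c05 c12 c13 c14 c15 c23 c24 c25 c34 c35 c45 =
      c23 • vw (b 2) (b 3) + c24 • vw (b 2) (b 4) + c34 • vw (b 3) (b 4)
        + vw (b 0) ρ + vw (b 1) σ := by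
    rw [hρ, hσ, z2, z3, z4]
    ext i j
    simp [comb, vw_apply]
    ring
  rw [hCe] at hC hli
  by_cases h0 : c23 = 0 ∧ c24 = 0 ∧ c34 = 0
  · exfalso
    obtain ⟨rfl, rfl, rfl⟩ := h0
    simp only [zero_smul, zero_add] at hC hli
    refine notMem_of_residue_eq_zero hπ hb hA hB hn0 hn (fun s t h => ?_) hC
    have := hli s t 1 (by rw [one_smul, h])
    exact one_ne_zero this.2.2
  · exact ⟨.five, pglEquivalent_planeFive_of_ne_zero hπ hb hA hB hn0 hn h0 hC⟩

/-! ### Invariants separating the four types -/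

/-- The matrices of the space have a common kernel vector. -/
def HasCommonKernel (π : Submodule ℂ Mat6) : Prop :=
  ∃ n : Fin 6 → ℂ, n ≠ 0 ∧ ∀ M ∈ π, M *ᵥ n = 0

/-- The vector `u` is orthogonal to the kernels of all nonzero matrices of the space. -/
def Annihilates (π : Submodule ℂ Mat6) (u : Fin 6 → ℂ) : Prop :=
  ∀ M ∈ π, M ≠ 0 → ∀ v, M *ᵥ v = 0 → u ⬝ᵥ v = 0

theorem congruence_mulVec (g : GL (Fin 6) ℂ) (M : Mat6) (v : Fin 6 → ℂ) :
    congruence g M *ᵥ v = g.val *ᵥ (M *ᵥ (g.val.transpose *ᵥ v)) := by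
  change (g.val * M * g.val.transpose) *ᵥ v = _
  simp [mulVec_mulVec, mul_assoc]

theorem HasCommonKernel.of_equivalent {π π' : Submodule ℂ Mat6} (h : PGLEquivalent π π')
    (hk : HasCommonKernel π) : HasCommonKernel π' := by
  obtain ⟨g, rfl⟩ := pglEquivalent_iff.1 h
  obtain ⟨n, hn0, hn⟩ := hk
  have hu : g.val.transpose * g⁻¹.val.transpose = 1 := by
    rw [← transpose_mul, Units.inv_mul, transpose_one]
  have he : g.val.transpose *ᵥ (g⁻¹.val.transpose *ᵥ n) = n := by
    rw [mulVec_mulVec, hu, one_mulVec]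
  refine ⟨g⁻¹.val.transpose *ᵥ n, fun h0 => hn0 ?_, ?_⟩
  · rw [← he, h0, mulVec_zero]
  · rintro _ ⟨M, hM, rfl⟩
    rw [congruence_mulVec, he, hn M hM, mulVec_zero]

/-- Kernels move by the inverse transpose of `g`, so vectors orthogonal to them move by `g`. -/
theorem Annihilates.map {π : Submodule ℂ Mat6} {u : Fin 6 → ℂ} (hu : Annihilates π u)
    (g : GL (Fin 6) ℂ) : Annihilates (π.map (congruence g)) (g.val *ᵥ u) := by
  rintro _ ⟨M, hM, rfl⟩ hM0 v hv
  have hM0' : M ≠ 0 := by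
    rintro rfl
    exact hM0 (map_zero _)
  rw [congruence_mulVec] at hv
  have hinj := Matrix.mulVec_injective_of_isUnit g.isUnit
  have := hu M hM hM0' _ (hinj (hv.trans (mulVec_zero _).symm))
  rwa [dotProduct_mulVec, vecMul_transpose] at this

theorem exists_annihilates_of_equivalent {π π' : Submodule ℂ Mat6} (h : PGLEquivalent π π')
    {m : ℕ} (hk : ∃ u : Fin m → Fin 6 → ℂ, LinearIndependent ℂ u ∧ ∀ i, Annihilates π (u i)) :
    ∃ u : Fin m → Fin 6 → ℂ, LinearIndependent ℂ u ∧ ∀ i, Annihilates π' (u i) := by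
  obtain ⟨g, rfl⟩ := pglEquivalent_iff.1 h
  obtain ⟨u, hu, hk⟩ := hk
  have hinj : Function.Injective g.val.mulVecLin := Matrix.mulVec_injective_of_isUnit g.isUnit
  refine ⟨g.val.mulVecLin ∘ u, hu.map' _ (LinearMap.ker_eq_bot.2 hinj), fun i => ?_⟩
  rw [Function.comp_apply, mulVecLin_apply]
  exact (hk i).map g

theorem hasCommonKernel_planeFive : HasCommonKernel planeFive := by
  refine ⟨Pi.single 5 1, by simp, fun M hM => ?_⟩
  obtain ⟨a, b, c, rfl⟩ := Submodule.mem_span_triple.1 hM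
  rw [planeFive_eq]
  ext i
  fin_cases i <;> simp [skewMat]

theorem coeff_ne_zero_of_ne_zero {X Y Z : Mat6} {a b c : ℂ} (h : a • X + b • Y + c • Z ≠ 0) :
    ¬(a = 0 ∧ b = 0 ∧ c = 0) := by
  rintro ⟨rfl, rfl, rfl⟩
  simp at h

theorem mem_planeG (a b c : ℂ) :
    skewMat 0 0 0 a b 0 (-a) 0 c (-b) (-c) 0 0 0 0 ∈ planeG := by
  rw [← planeG_eq]
  exact Submodule.mem_span_triple.2 ⟨a, b, c, rfl⟩

theorem mem_planeT (a b c : ℂ) : skewMat 0 a b c 0 0 a b c 0 0 0 0 0 0 ∈ planeT := by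
  rw [← planeT_eq]
  exact Submodule.mem_span_triple.2 ⟨a, b, c, rfl⟩

theorem mem_planeP (a b c : ℂ) : skewMat 0 0 a b c a c 0 0 b 0 0 0 0 0 ∈ planeP := by
  rw [← planeP_eq]
  exact Submodule.mem_span_triple.2 ⟨a, b, c, rfl⟩

theorem not_hasCommonKernel_planeG : ¬HasCommonKernel planeG := by
  rintro ⟨n, hn0, hn⟩
  apply hn0
  have h1 := hn _ (mem_planeG 1 0 0)
  have h2 := hn _ (mem_planeG 0 1 0)
  have e0 := congrFun h1 4
  have e1 := congrFun h1 3
  have e3 := congrFun h1 1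
  have e4 := congrFun h1 0
  have e2 := congrFun h2 3
  have e5 := congrFun h2 0
  simp [skewMat, Matrix.mulVec, dotProduct, Fin.sum_univ_six] at e0 e1 e2 e3 e4 e5
  ext i
  fin_cases i <;> assumption

theorem not_hasCommonKernel_planeT : ¬HasCommonKernel planeT := by
  rintro ⟨n, hn0, hn⟩
  apply hn0
  have h1 := hn _ (mem_planeT 1 0 0)
  have h2 := hn _ (mem_planeT 0 0 1)
  have e0 := congrFun h1 2
  have e1 := congrFun h1 3
  have e2 := congrFun h1 0
  have e3 := congrFun h1 1
  have e4 := congrFun h2 0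
  have e5 := congrFun h2 1
  simp [skewMat, Matrix.mulVec, dotProduct, Fin.sum_univ_six] at e0 e1 e2 e3 e4 e5
  ext i
  fin_cases i <;> assumption

theorem not_hasCommonKernel_planeP : ¬HasCommonKernel planeP := by
  rintro ⟨n, hn0, hn⟩
  apply hn0
  have h1 := hn _ (mem_planeP 1 0 0)
  have h2 := hn _ (mem_planeP 0 1 0)
  have h3 := hn _ (mem_planeP 0 0 1)
  have e0 := congrFun h1 3
  have e1 := congrFun h1 2
  have e2 := congrFun h1 1
  have e3 := congrFun h1 0
  have e4 := congrFun h2 0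
  have e5 := congrFun h3 0
  simp [skewMat, Matrix.mulVec, dotProduct, Fin.sum_univ_six] at e0 e1 e2 e3 e4 e5
  ext i
  fin_cases i <;> assumption

theorem annihilates_planeT {i : Fin 6} (hi : i = 0 ∨ i = 1) :
    Annihilates planeT (Pi.single i 1) := by
  intro M hM hM0 v hv
  obtain ⟨a, b, c, rfl⟩ := Submodule.mem_span_triple.1 hM
  have hne := coeff_ne_zero_of_ne_zero hM0
  rw [planeT_eq] at hv
  have e2 := congrFun hv 2
  have e3 := congrFun hv 3
  have e4 := congrFun hv 4
  have e5 := congrFun hv 5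
  simp [skewMat, Matrix.mulVec, dotProduct, Fin.sum_univ_six] at e2 e3 e4 e5
  have h : v 0 = 0 ∧ v 1 = 0 := by
    by_cases ha : a = 0
    · by_cases hb : b = 0
      · have hc : c ≠ 0 := fun hc => hne ⟨ha, hb, hc⟩
        simp [hb, hc] at e4 e5
        exact ⟨e4, e5⟩
      · simp [ha, hb] at e3
        simp [e3, hb] at e4
        exact ⟨e3, e4⟩
    · simp [ha] at e2
      simp [e2, ha] at e3
      exact ⟨e2, e3⟩
  rcases hi with rfl | rfl
  · simpa using h.1
  · simpa using h.2

theorem annihilates_planeP : Annihilates planeP (Pi.single 0 1) := by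
  intro M hM hM0 v hv
  obtain ⟨a, b, c, rfl⟩ := Submodule.mem_span_triple.1 hM
  have hne := coeff_ne_zero_of_ne_zero hM0
  rw [planeP_eq] at hv
  have e1 := congrFun hv 1
  have e2 := congrFun hv 2
  have e3 := congrFun hv 3
  have e4 := congrFun hv 4
  have e5 := congrFun hv 5
  simp [skewMat, Matrix.mulVec, dotProduct, Fin.sum_univ_six] at e1 e2 e3 e4 e5
  rcases e4 with rfl | h
  · rcases e5 with rfl | h
    · have ha : a ≠ 0 := fun ha => hne ⟨ha, rfl, rfl⟩
      simp [ha] at e3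
      simpa using e3
    · simpa using h
  · simpa using h

theorem skewMat_ne_zero {c01 c02 c03 c04 c05 c12 c13 c14 c15 c23 c24 c25 c34 c35 c45 : ℂ}
    (h : ¬(c03 = 0 ∧ c04 = 0 ∧ c05 = 0 ∧ c15 = 0)) :
    skewMat c01 c02 c03 c04 c05 c12 c13 c14 c15 c23 c24 c25 c34 c35 c45 ≠ 0 := by
  intro h0
  have e1 := congrFun (congrFun h0 0) 3
  have e2 := congrFun (congrFun h0 0) 4
  have e3 := congrFun (congrFun h0 0) 5
  have e4 := congrFun (congrFun h0 1) 5
  simp [skewMat] at e1 e2 e3 e4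
  exact h ⟨e1, e2, e3, e4⟩

theorem eq_zero_of_annihilates_planeG {u : Fin 6 → ℂ} (hu : Annihilates planeG u) : u = 0 := by
  have h1 := hu _ (mem_planeG 1 0 0) (skewMat_ne_zero (by simp))
  have h2 := hu _ (mem_planeG 0 1 0) (skewMat_ne_zero (by simp))
  have h3 := hu _ (mem_planeG 0 0 1) (skewMat_ne_zero (by simp))
  have e2 := h1 (Pi.single 2 1) (by ext i; fin_cases i <;> simp [skewMat])
  have e5 := h1 (Pi.single 5 1) (by ext i; fin_cases i <;> simp [skewMat])
  have e1 := h2 (Pi.single 1 1) (by ext i; fin_cases i <;> simp [skewMat])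
  have e4 := h2 (Pi.single 4 1) (by ext i; fin_cases i <;> simp [skewMat])
  have e0 := h3 (Pi.single 0 1) (by ext i; fin_cases i <;> simp [skewMat])
  have e3 := h3 (Pi.single 3 1) (by ext i; fin_cases i <;> simp [skewMat])
  simp at e0 e1 e2 e3 e4 e5
  ext i
  fin_cases i <;> assumption

/-- Kernel vectors of the generators eliminate the coordinates 1, 2, 4, 5; coordinate 3 needs a
mixed member. -/
theorem eq_single_of_annihilates_planeP {u : Fin 6 → ℂ} (hu : Annihilates planeP u) :
    u = u 0 • Pi.single 0 1 := by
  have h1 := hu _ (mem_planeP 1 0 0) (skewMat_ne_zero (by simp))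
  have h2 := hu _ (mem_planeP 0 1 0) (skewMat_ne_zero (by simp))
  have h3 := hu _ (mem_planeP 0 0 1) (skewMat_ne_zero (by simp))
  have h4 := hu _ (mem_planeP 1 1 0) (skewMat_ne_zero (by simp))
  have e4 := h1 (Pi.single 4 1) (by ext i; fin_cases i <;> simp [skewMat])
  have e5 := h1 (Pi.single 5 1) (by ext i; fin_cases i <;> simp [skewMat])
  have e1 := h2 (Pi.single 1 1) (by ext i; fin_cases i <;> simp [skewMat])
  have e2 := h3 (Pi.single 2 1) (by ext i; fin_cases i <;> simp [skewMat])
  -- A kernel vector of the sum of the first two generators.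
  have e3 := h4 (Pi.single 1 1 + Pi.single 3 1 - Pi.single 4 1) (by
    ext i; fin_cases i <;> simp [skewMat, mulVec_add, mulVec_sub])
  simp at e1 e2 e4 e5
  simp [dotProduct_add, dotProduct_sub, e1, e4] at e3
  ext i
  fin_cases i <;> simp [e1, e2, e3, e4, e5]

theorem exists_annihilates_planeT :
    ∃ u : Fin 2 → Fin 6 → ℂ, LinearIndependent ℂ u ∧ ∀ i, Annihilates planeT (u i) := by
  refine ⟨![Pi.single 0 1, Pi.single 1 1], ?_, ?_⟩
  · rw [LinearIndependent.pair_iff]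
    intro s t h
    have h0 := congrFun h 0
    have h1 := congrFun h 1
    simp at h0 h1
    exact ⟨h0, h1⟩
  · intro i
    fin_cases i
    · exact annihilates_planeT (Or.inl rfl)
    · exact annihilates_planeT (Or.inr rfl)

theorem not_exists_annihilates_planeP :
    ¬∃ u : Fin 2 → Fin 6 → ℂ, LinearIndependent ℂ u ∧ ∀ i, Annihilates planeP (u i) := by
  rintro ⟨u, hu, hP⟩
  have h0 := eq_single_of_annihilates_planeP (hP 0)
  have h1 := eq_single_of_annihilates_planeP (hP 1)
  have := Fintype.linearIndependent_iff.1 hu ![u 1 0, -u 0 0] (by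
    rw [Fin.sum_univ_two, h0, h1]
    simp [smul_smul, mul_comm])
  have z := this 1
  simp at z
  apply hu.ne_zero 0
  rw [h0, z, zero_smul]

theorem not_exists_annihilates_planeG :
    ¬∃ u : Fin 1 → Fin 6 → ℂ, LinearIndependent ℂ u ∧ ∀ i, Annihilates planeG (u i) := by
  rintro ⟨u, hu, hG⟩
  exact hu.ne_zero 0 (eq_zero_of_annihilates_planeG (hG 0))

theorem exists_annihilates_one {π : Submodule ℂ Mat6} {u : Fin 6 → ℂ} (hu0 : u ≠ 0)
    (hu : Annihilates π u) :
    ∃ u : Fin 1 → Fin 6 → ℂ, LinearIndependent ℂ u ∧ ∀ i, Annihilates π (u i) :=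
  ⟨fun _ => u, LinearIndependent.of_subsingleton 0 hu0, fun _ => hu⟩

/-- A common kernel isolates `π_5`; one annihilating vector separates `π_g` from `π_t` and `π_p`;
two independent ones separate `π_t` from `π_p`. -/
theorem eq_of_pglEquivalent {i j : PlaneType}
    (h : PGLEquivalent (standardPlane i) (standardPlane j)) : i = j := by
  have hT1 := exists_annihilates_one (by simp) (annihilates_planeT (Or.inl rfl))
  have hP1 := exists_annihilates_one (by simp) annihilates_planeP
  have k := HasCommonKernel.of_equivalent h
  have k' := HasCommonKernel.of_equivalent h.symm
  have m := exists_annihilates_of_equivalent (m := 1) h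
  have m' := exists_annihilates_of_equivalent (m := 1) h.symm
  have l := exists_annihilates_of_equivalent (m := 2) h
  have l' := exists_annihilates_of_equivalent (m := 2) h.symm
  cases i <;> cases j <;> simp only [standardPlane] at k k' m m' l l' <;>
    first
    | rfl
    | exact absurd (k hasCommonKernel_planeFive) not_hasCommonKernel_planeG
    | exact absurd (k hasCommonKernel_planeFive) not_hasCommonKernel_planeT
    | exact absurd (k hasCommonKernel_planeFive) not_hasCommonKernel_planeP
    | exact absurd (k' hasCommonKernel_planeFive) not_hasCommonKernel_planeG
    | exact absurd (k' hasCommonKernel_planeFive) not_hasCommonKernel_planeT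
    | exact absurd (k' hasCommonKernel_planeFive) not_hasCommonKernel_planeP
    | exact absurd (m hT1) not_exists_annihilates_planeG
    | exact absurd (m' hT1) not_exists_annihilates_planeG
    | exact absurd (m hP1) not_exists_annihilates_planeG
    | exact absurd (m' hP1) not_exists_annihilates_planeG
    | exact absurd (l exists_annihilates_planeT) not_exists_annihilates_planeP
    | exact absurd (l' exists_annihilates_planeT) not_exists_annihilates_planeP

end SkewPlanes

end

theorem mainTheorem1 :
    (∀ i : SkewPlanes.PlaneType,
      SkewPlanes.IsConstantRankFourPlane (SkewPlanes.standardPlane i)) ∧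
    ∀ π : Submodule ℂ SkewPlanes.Mat6, SkewPlanes.IsConstantRankFourPlane π →
      ∃! i : SkewPlanes.PlaneType, SkewPlanes.PGLEquivalent π (SkewPlanes.standardPlane i) := by
  refine ⟨SkewPlanes.isConstantRankFourPlane_standardPlane, fun π hπ => ?_⟩
  obtain ⟨i, hi⟩ := SkewPlanes.exists_pglEquivalent hπ
  exact ⟨i, hi, fun j hj => SkewPlanes.eq_of_pglEquivalent (hj.symm.trans hi)⟩
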